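/- **Proposition (Height bound).** Let $m,n\ge 1$ be integers, write $\mathbb{R}^{m+n}=\mathbb{R}^m\times\mathbb{R}^n\ni z=(x,y)$ and let $\mathbf{C}_r=\{(x,y): |x|<r\}$. There are constants $C\ge 0$ and $\delta_0>0$, depending only on $m$ and $n$, with the following property. Assume that: (i) $M\subset\mathbb{R}^{m+n}$ is a smooth ($C^\infty$) embedded $m$-dimensional submanifold which is $\delta$-flat in $\mathbf{C}_2$ for some $\delta\le\delta_0$, that is, $M\cap\mathbf{C}_2$ is the graph of a map $g\in C^2(B_2,\mathbb{R}^n)$, where $B_2=\{x\in\mathbb{R}^m:|x|<2\}$, with $$\sup_{x\in B_2}\Big(\tfrac12|g(x)|+|Dg(x)|+2|D^2g(x)|\Big)\le\delta ;$$ (ii) $V$ is an integer rectifiable $m$-dimensional varifold in $\mathbf{C}_1$: its weight is a Radon measure $\|V\|=\Theta\,\mathcal{H}^m\llcorner E$ on $\mathbf{C}_1$, where $E\subset\mathbf{C}_1$ is an $m$-rectifiable Borel set and $\Theta$ is a Borel function with positive integer values $\mathcal{H}^m$-a.e. on $E$, and $T_zV$ denotes the approximate tangent plane of $E$ at $\|V\|$-a.e.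 $z$. Moreover $V$ is stationary in $\mathbf{C}_1$, i.e. $\int \mathrm{div}_{T_zV}X(z)\,d\|V\|(z)=0$ for every $X\in C_c^\infty(\mathbf{C}_1,\mathbb{R}^{m+n})$, and its support in $\mathbf{C}_1$ satisfies $\mathrm{supp}(V)\subset\{(x,y):|x|<1,\ |y|<1\}$. Then, denoting by $d_M$ the distance function from $M$ and by $H_M$ the mean curvature vector of $M$, $$\sup_{\mathrm{supp}(V)\cap\mathbf{C}_{1/2}}d_M^2\ \le\ C\Big(\int_{\mathbf{C}_1}d_M^2\,d\|V\|+\|V\|(\mathbf{C}_1)\,\sup_{M\cap\mathbf{C}_1}|H_M|^2\Big),$$ where both sides take values in $[0,\infty]$, with the conventions $0\cdot\infty=0$ and $\sup\emptyset=0$. -/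

import Mathlib

open MeasureTheory Filter Topology Set
open scoped ENNReal NNReal ContDiff

noncomputable section

namespace HeightBound

/-! ### The ambient space and cylinders -/

/-- The Euclidean space `ℝ^{m+n} = ℝ^m × ℝ^n`; the reference plane `π₀` is `ℝ^m × {0}`. -/
abbrev Space (m n : ℕ) : Type :=
  WithLp 2 (EuclideanSpace ℝ (Fin m) × EuclideanSpace ℝ (Fin n))

/-- The open cylinder `C_r = B_r(0, π₀) + π₀^⊥`. -/
def cyl (m n : ℕ) (r : ℝ) : Set (Space m n) := {z | ‖z.fst‖ < r}

/-! ### Submanifolds, second fundamental form, mean curvature -/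

/-- `M` is an embedded `m`-dimensional `C^∞` submanifold of `ℝ^{m+n}` (not necessarily closed):
near each of its points a `C^∞` diffeomorphism between open sets straightens it to
`ℝ^m × {0}`. -/
def IsSmoothSubmanifold {m n : ℕ} (M : Set (Space m n)) : Prop :=
  ∀ p ∈ M, ∃ Φ : OpenPartialHomeomorph (Space m n) (Space m n),
    p ∈ Φ.source ∧ ContDiffOn ℝ ∞ Φ Φ.source ∧ ContDiffOn ℝ ∞ Φ.symm Φ.target ∧
      ∀ z ∈ Φ.source, z ∈ M ↔ (Φ z).snd = 0

/-- `δ`-flatness in `C_r`: `M ∩ C_r` is the graph of some `g ∈ C²(B_r, ℝ^n)` with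
`r⁻¹ |g| + |Dg| + r |D²g| ≤ δ` on `B_r`. -/
def IsFlat {m n : ℕ} (M : Set (Space m n)) (r δ : ℝ) : Prop :=
  ∃ g : EuclideanSpace ℝ (Fin m) → EuclideanSpace ℝ (Fin n),
    ContDiffOn ℝ 2 g (Metric.ball 0 r) ∧
    M ∩ cyl m n r = {z | z.fst ∈ Metric.ball 0 r ∧ z.snd = g z.fst} ∧
    ∀ x ∈ Metric.ball (0 : EuclideanSpace ℝ (Fin m)) r,
      r⁻¹ * ‖g x‖ + ‖fderiv ℝ g x‖ + r * ‖fderiv ℝ (fderiv ℝ g) x‖ ≤ δ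

section Curvature

variable {E : Type*} [NormedAddCommGroup E] [InnerProductSpace ℝ E] [FiniteDimensional ℝ E]

/-- The tangent space `T_p M`. -/
def tangentPlane (M : Set E) (p : E) : Submodule ℝ E :=
  Submodule.span ℝ (tangentConeAt ℝ M p)

/-- `W` is a `C¹` vector field near `p`, tangent to `M` along `M`, with `W(p) = w`. -/
def IsTangentExtension (M : Set E) (p w : E) (W : E → E) : Prop :=
  ContDiffAt ℝ 1 W p ∧ W p = w ∧ ∀ᶠ q in 𝓝[M] p, W q ∈ tangentPlane M q

open Classical in
/-- The second fundamental form `II(v, w) = (D_v W)^⊥` of `M` at `p`, where `v, w ∈ T_p M` and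
`W` is any tangential `C¹` extension of `w` (on a `C²` submanifold such extensions exist and
the value does not depend on the choice). -/
def secondFundamentalForm (M : Set E) (p v w : E) : E :=
  if h : ∃ W : E → E, IsTangentExtension M p w W then
    (tangentPlane M p)ᗮ.starProjection (fderiv ℝ h.choose p v)
  else 0

/-- The mean curvature vector `H_M(p) = ∑ᵢ II(eᵢ, eᵢ)`, where `(eᵢ)` is an orthonormal basis
of `T_p M`. -/
def meanCurvature (M : Set E) (p : E) : E :=
  ∑ i, secondFundamentalForm M p
    (stdOrthonormalBasis ℝ (tangentPlane M p) i) (stdOrthonormalBasis ℝ (tangentPlane M p) i)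

end Curvature

/-! ### The Grassmannian and varifolds -/

/-- The Grassmannian of (unoriented) `m`-dimensional linear subspaces of `E`. -/
def Gr (m : ℕ) (E : Type*) [NormedAddCommGroup E] [InnerProductSpace ℝ E] : Type _ :=
  {S : Submodule ℝ E // Module.finrank ℝ S = m}

section Varifold

variable {E : Type*} [NormedAddCommGroup E] [InnerProductSpace ℝ E] [FiniteDimensional ℝ E]
  {m : ℕ}

/-- The orthogonal projection onto an element of the Grassmannian. -/
def Gr.proj (S : Gr m E) : E →L[ℝ] E := S.1.starProjection

/-- The usual topology: planes are close if their orthogonal projections are. -/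
instance : TopologicalSpace (Gr m E) := TopologicalSpace.induced Gr.proj inferInstance

instance : MeasurableSpace (Gr m E) := borel _

/-- `div_S X (x) = ∑ᵢ ⟨eᵢ, D_{eᵢ} X(x)⟩ = trace (p_S ∘ DX(x))`, with `(eᵢ)` an orthonormal
basis of `S`. -/
def divAlong (S : Gr m E) (X : E → E) (x : E) : ℝ :=
  LinearMap.trace ℝ E (S.proj ∘L fderiv ℝ X x : E →L[ℝ] E)

variable [MeasurableSpace E]

/-- The weight `‖V‖` of a varifold: the marginal of `V` on the ambient space. -/
def weight (V : Measure (E × Gr m E)) : Measure E := V.map Prod.fst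

/-- An `m`-dimensional varifold in `U`: a Radon measure on `U × Gr m E`, regarded as a measure on
`E × Gr m E` which vanishes outside of `U × Gr m E`. -/
def IsVarifold (U : Set E) (V : Measure (E × Gr m E)) : Prop :=
  V (Uᶜ ×ˢ univ) = 0 ∧ ∀ K ⊆ U, IsCompact K → V (K ×ˢ univ) < ⊤

/-- The support of (the weight of) a varifold in `U`, which is a relatively closed subset
of `U`. -/
def vsupp (U : Set E) (V : Measure (E × Gr m E)) : Set E := (weight V).support ∩ U

/-- `V` is stationary in `U`: the first variation `δV(X) = ∫ div_S X(x) dV(x, S)` vanishes for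
every `X ∈ C_c^∞(U, E)`. -/
def IsStationary (U : Set E) (V : Measure (E × Gr m E)) : Prop :=
  ∀ X : E → E, ContDiff ℝ ∞ X → HasCompactSupport X → tsupport X ⊆ U →
    ∫ q, divAlong q.2 X q.1 ∂V = 0

variable [BorelSpace E]

/-- `A` is (countably) `m`-rectifiable: `ℋ^m`-almost all of `A` is covered by countably many
Lipschitz images of `ℝ^m`. -/
def IsRectifiable (m : ℕ) (A : Set E) : Prop :=
  ∃ f : ℕ → EuclideanSpace ℝ (Fin m) → E,
    (∀ i, ∃ K : ℝ≥0, LipschitzWith K (f i)) ∧ μHE[m] (A \ ⋃ i, range (f i)) = 0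

/-- `S` is the approximate tangent plane of `A` at `x`: the blow-ups of `ℋ^m ⌞ A` at `x`
converge to `ℋ^m ⌞ S` in duality with `C_c`. -/
def IsApproxTangent (A : Set E) (x : E) (S : Gr m E) : Prop :=
  ∀ φ : E → ℝ, Continuous φ → HasCompactSupport φ →
    Tendsto (fun r : ℝ => (r ^ m)⁻¹ * ∫ y in A, φ (r⁻¹ • (y - x)) ∂μHE[m]) (𝓝[>] 0)
      (𝓝 (∫ y in (S.1 : Set E), φ y ∂μHE[m]))

/-- `V` is an integer rectifiable `m`-varifold in `U`: `‖V‖ = Θ ℋ^m ⌞ A` with `A ⊆ U`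
`m`-rectifiable and `Θ` Borel with positive integer values, and `V` disintegrates with respect
to `‖V‖` into the Dirac masses at the approximate tangent planes of `A`. -/
def IsIntegralVarifold (U : Set E) (V : Measure (E × Gr m E)) : Prop :=
  IsVarifold U V ∧
  ∃ (A : Set E) (Θ : E → ℕ) (T : E → Gr m E),
    A ⊆ U ∧ MeasurableSet A ∧ IsRectifiable m A ∧
    Measurable Θ ∧ (∀ᵐ x ∂((μHE[m] : Measure E).restrict A), 1 ≤ Θ x) ∧
    weight V = ((μHE[m] : Measure E).restrict A).withDensity (fun x => (Θ x : ℝ≥0∞)) ∧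
    Measurable T ∧ (∀ᵐ x ∂(weight V), IsApproxTangent A x (T x)) ∧
    V = (weight V).map (fun x => (x, T x))

end Varifold

end HeightBound

end

/-! Let `f(x, y) = |y - g(x)|²` be the squared vertical height over the graph. On the support of `V`
in the unit cylinder it is comparable to `d_M²`, so it suffices to bound `f` pointwise by its
integral plus a mean curvature term.

Along an arbitrary `m`-plane `S` with orthonormal basis `(e_j)`, the trace of `D²f` is `2D - 2 ∑ ⟨y
- g, D²g(e_j, e_j)⟩`, where `D` is the sum of the squares `|e_j^y - Dg(e_j^x)|²` and measures the
tilt of `S` against the graph. Over the tangent plane of `M` the Hessian trace is controlled by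
`|H_M|`; passing from that plane to `S` costs a multiple of `δ |y - g| √D`, which half of the good
term `2D` absorbs. Hence `div_S ∇f ≥ D - (3/80) f - 160 k²`, where `k` bounds `|H_M|`
(`divAlong_gradField_heightSq_ge`). The quadratic corrections in `barrier` turn `f` into a
nonnegative function that is subharmonic along every `m`-plane and equals `f` at the centre `p`
(`divAlong_barrierGrad_nonneg`).

For such a function `h`, Green's formula with a regularized, truncated fundamental solution, tested
in the stationarity of `V`, gives `∫_{B_σ(p)} h ≤ K σ^m ∫_{B_ρ(p)} h` (`exists_mean_value_bound`).
Almost every point of an integral varifold has positive lower density, with a constant depending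
only on `m` (`IsIntegralVarifold.ae_density`), so letting `σ → 0` bounds `h(p)`. No monotonicity
formula is needed: the remaining points of the support are reached by continuity of `f`.
Stationarity is tested with `C^∞` fields, whence the need for `contDiffOn_of_isSmoothSubmanifold`,
which upgrades `g` from `C²` to `C^∞`. -/

noncomputable section

namespace HeightBound

open scoped RealInnerProductSpace

/-! ### Traces over subspaces and the distance between planes -/

section LinearAlgebra

variable {E : Type*} [NormedAddCommGroup E] [InnerProductSpace ℝ E] [FiniteDimensional ℝ E]
variable {ι κ κ' : Type*} [Fintype ι] [Fintype κ] [Fintype κ']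

/-- The trace of a bilinear map over a subspace, computed in an orthonormal basis of the ambient
space or of the subspace. -/
theorem sum_bilin_starProjection {G : Type*} [AddCommGroup G] [Module ℝ G]
    (B : E →ₗ[ℝ] E →ₗ[ℝ] G) (b : OrthonormalBasis ι ℝ E) {S : Submodule ℝ E}
    (e : OrthonormalBasis κ ℝ S) :
    ∑ i, B (b i) (S.starProjection (b i)) = ∑ j, B (e j) (e j) := by
  have h1 : ∀ x, S.starProjection x = ∑ j, ⟪(e j : E), x⟫ • (e j : E) := by
    intro x
    rw [e.starProjection_eq_sum_rankOne]
    simp [InnerProductSpace.rankOne_apply]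
  simp_rw [h1, map_sum, map_smul]
  rw [Finset.sum_comm]
  refine Finset.sum_congr rfl fun j _ => ?_
  have h2 : (e j : E) = ∑ i, ⟪b i, (e j : E)⟫ • b i := (b.sum_repr' _).symm
  conv_rhs => enter [1]; rw [h2]
  rw [map_sum, LinearMap.sum_apply]
  refine Finset.sum_congr rfl fun i _ => ?_
  rw [map_smul, LinearMap.smul_apply, real_inner_comm]

theorem norm_orthonormalBasis_coe {E : Type*} [NormedAddCommGroup E] [InnerProductSpace ℝ E]
    {S : Submodule ℝ E} (e : OrthonormalBasis κ ℝ S) (j : κ) :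
    ‖(e j : E)‖ = 1 := e.orthonormal.1 j

/-- The Hilbert-Schmidt distance between the projections onto two subspaces of equal dimension. -/
theorem sum_norm_sq_starProjection_sub (b : OrthonormalBasis ι ℝ E) {S T : Submodule ℝ E}
    (e : OrthonormalBasis κ ℝ S) (e' : OrthonormalBasis κ' ℝ T)
    (hcard : Fintype.card κ = Fintype.card κ') :
    ∑ i, ‖S.starProjection (b i) - T.starProjection (b i)‖ ^ 2
      = 2 * ∑ j, ‖Tᗮ.starProjection (e j : E)‖ ^ 2 := by
  have hsq : ∀ (R : Submodule ℝ E) (x : E), ‖R.starProjection x‖ ^ 2 = ⟪x, R.starProjection x⟫ := by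
    intro R x
    rw [← real_inner_self_eq_norm_sq, R.inner_starProjection_left_eq_right,
      R.starProjection_eq_self_iff.2 (R.starProjection_apply_mem x)]
  -- Expanding the square gives `tr P_S + tr P_T - 2 tr (P_T P_S)`. The first two traces are the
  -- common dimension, and the last is `∑ |P_T e_j|² = ∑ (1 - |P_{T^⊥} e_j|²)`.
  have hS : ∑ i, ⟪b i, S.starProjection (b i)⟫ = Fintype.card κ := by
    have := sum_bilin_starProjection (innerₗ E) b e
    simp only [innerₗ_apply_apply, real_inner_self_eq_norm_sq, norm_orthonormalBasis_coe] at this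
    simpa using this
  have hT : ∑ i, ⟪b i, T.starProjection (b i)⟫ = Fintype.card κ' := by
    have := sum_bilin_starProjection (innerₗ E) b e'
    simp only [innerₗ_apply_apply, real_inner_self_eq_norm_sq, norm_orthonormalBasis_coe] at this
    simpa using this
  have hST : ∑ i, ⟪T.starProjection (b i), S.starProjection (b i)⟫
      = ∑ j, ‖T.starProjection (e j : E)‖ ^ 2 := by
    have := sum_bilin_starProjection ((innerₗ E).comp (T.starProjection : E →ₗ[ℝ] E)) b e
    simp only [LinearMap.comp_apply, innerₗ_apply_apply, ContinuousLinearMap.coe_coe] at this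
    rw [this]
    refine Finset.sum_congr rfl fun j _ => ?_
    rw [hsq, real_inner_comm]
  have hperp : ∀ j, ‖Tᗮ.starProjection (e j : E)‖ ^ 2 = 1 - ‖T.starProjection (e j : E)‖ ^ 2 := by
    intro j
    have := Submodule.norm_sq_eq_add_norm_sq_starProjection (e j : E) T
    rw [norm_orthonormalBasis_coe] at this
    linarith
  simp_rw [hperp, norm_sub_sq_real, hsq S, hsq T (b _)]
  rw [Finset.sum_add_distrib, Finset.sum_sub_distrib, hS, hT, Finset.sum_sub_distrib, ← hST]
  simp_rw [real_inner_comm (T.starProjection (b _)) (S.starProjection (b _))]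
  rw [← Finset.mul_sum, ← hcard]
  simp
  ring

/-- Comparison of the traces of a bilinear form over two subspaces of equal dimension. -/
theorem abs_sum_bilin_sub_le (B : E →ₗ[ℝ] E →ₗ[ℝ] ℝ) {K : ℝ}
    (hB : ∀ v w, |B v w| ≤ K * ‖v‖ * ‖w‖) {S T : Submodule ℝ E}
    (e : OrthonormalBasis κ ℝ S) (e' : OrthonormalBasis κ' ℝ T)
    (hcard : Fintype.card κ = Fintype.card κ') :
    |∑ j, B (e j) (e j) - ∑ j, B (e' j) (e' j)|
      ≤ K * √(Module.finrank ℝ E * (2 * ∑ j, ‖Tᗮ.starProjection (e j : E)‖ ^ 2)) := by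
  set b := stdOrthonormalBasis ℝ E
  -- Written in one ambient basis, both traces pair `b i` with its projection, so their difference
  -- only sees `P_S - P_T`. Cauchy-Schwarz over the basis then produces the factor `finrank ℝ E`.
  rw [← sum_bilin_starProjection B b e, ← sum_bilin_starProjection B b e',
    ← Finset.sum_sub_distrib]
  simp_rw [← map_sub]
  by_cases hE : Module.finrank ℝ E = 0
  · have : IsEmpty (Fin (Module.finrank ℝ E)) := by rw [hE]; infer_instance
    simp [hE]
  have hK : 0 ≤ K := by
    have i : Fin (Module.finrank ℝ E) := ⟨0, Nat.pos_of_ne_zero hE⟩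
    have := (abs_nonneg _).trans (hB (b i) (b i))
    simpa [b.orthonormal.1 i] using this
  rw [← sum_norm_sq_starProjection_sub b e e' hcard]
  have h1 : |∑ i, B (b i) (S.starProjection (b i) - T.starProjection (b i))|
      ≤ K * ∑ i, ‖S.starProjection (b i) - T.starProjection (b i)‖ := by
    rw [Finset.mul_sum]
    refine (Finset.abs_sum_le_sum_abs _ _).trans (Finset.sum_le_sum fun i _ => ?_)
    simpa [b.orthonormal.1 i] using hB (b i) (S.starProjection (b i) - T.starProjection (b i))
  refine h1.trans (mul_le_mul_of_nonneg_left ?_ hK)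
  refine Real.le_sqrt_of_sq_le ?_
  have := sq_sum_le_card_mul_sum_sq (s := Finset.univ)
    (f := fun i => ‖S.starProjection (b i) - T.starProjection (b i)‖)
  simpa using this

/-- The operator norm on a subspace is at most the Hilbert-Schmidt norm. -/
theorem norm_sq_map_starProjection_le {G : Type*} [NormedAddCommGroup G] [InnerProductSpace ℝ G]
    (L : E →L[ℝ] G) {S : Submodule ℝ E} (e : OrthonormalBasis κ ℝ S) (x : E) :
    ‖L (S.starProjection x)‖ ^ 2 ≤ (∑ j, ‖L (e j)‖ ^ 2) * ‖x‖ ^ 2 := by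
  have h1 : S.starProjection x = ∑ j, ⟪(e j : E), x⟫ • (e j : E) := by
    rw [e.starProjection_eq_sum_rankOne]
    simp [InnerProductSpace.rankOne_apply]
  have h2 : ∑ j, ⟪(e j : E), x⟫ ^ 2 ≤ ‖x‖ ^ 2 := by
    have ho : Orthonormal ℝ (fun j => (e j : E)) := by
      simpa [Function.comp_def] using e.orthonormal.comp_linearIsometry S.subtypeₗᵢ
    have := ho.sum_inner_products_le x (s := Finset.univ)
    simpa using this
  have h3 : ‖L (S.starProjection x)‖ ≤ ∑ j, |⟪(e j : E), x⟫| * ‖L (e j)‖ := by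
    rw [h1, map_sum]
    refine (norm_sum_le _ _).trans (Finset.sum_le_sum fun j _ => ?_)
    rw [map_smul, norm_smul, Real.norm_eq_abs]
  calc ‖L (S.starProjection x)‖ ^ 2 ≤ (∑ j, |⟪(e j : E), x⟫| * ‖L (e j)‖) ^ 2 := by gcongr
    _ ≤ (∑ j, |⟪(e j : E), x⟫| ^ 2) * ∑ j, ‖L (e j)‖ ^ 2 :=
        Finset.sum_mul_sq_le_sq_mul_sq _ _ _
    _ = (∑ j, ⟪(e j : E), x⟫ ^ 2) * ∑ j, ‖L (e j)‖ ^ 2 := by simp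
    _ ≤ ‖x‖ ^ 2 * ∑ j, ‖L (e j)‖ ^ 2 := by gcongr
    _ = _ := mul_comm _ _

end LinearAlgebra

/-! ### Calculus of the tangential divergence -/

section Divergence

variable {E : Type*} [NormedAddCommGroup E] [InnerProductSpace ℝ E] [FiniteDimensional ℝ E]
  {m : ℕ}

theorem Gr.inner_proj (S : Gr m E) (v w : E) : ⟪S.proj v, w⟫ = ⟪v, S.proj w⟫ :=
  S.1.inner_starProjection_left_eq_right v w

theorem divAlong_eq_sum {κ : Type*} [Fintype κ] (S : Gr m E) (e : OrthonormalBasis κ ℝ S.1)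
    (X : E → E) (x : E) : divAlong S X x = ∑ j, ⟪(e j : E), fderiv ℝ X x (e j)⟫ := by
  set b := stdOrthonormalBasis ℝ E
  rw [divAlong, LinearMap.trace_eq_sum_inner _ b]
  have := sum_bilin_starProjection ((innerₗ E).comp (fderiv ℝ X x : E →ₗ[ℝ] E)) b e
  simp only [LinearMap.comp_apply, innerₗ_apply_apply, ContinuousLinearMap.coe_coe] at this
  simp_rw [real_inner_comm _ ((e _ : S.1) : E)]
  rw [← this]
  refine Finset.sum_congr rfl fun i _ => ?_
  rw [ContinuousLinearMap.coe_coe, ContinuousLinearMap.comp_apply, ← Gr.inner_proj, real_inner_comm]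
  rfl

theorem divAlong_add (S : Gr m E) {X Y : E → E} {x : E} (hX : DifferentiableAt ℝ X x)
    (hY : DifferentiableAt ℝ Y x) :
    divAlong S (fun z => X z + Y z) x = divAlong S X x + divAlong S Y x := by
  rw [divAlong, fderiv_fun_add hX hY]
  simp [divAlong, ContinuousLinearMap.comp_add]

theorem divAlong_smul (S : Gr m E) {a : E → ℝ} {a' : E →L[ℝ] ℝ} {X : E → E} {x : E}
    (ha : HasFDerivAt a a' x) (hX : DifferentiableAt ℝ X x) :
    divAlong S (fun z => a z • X z) x = a x * divAlong S X x + a' (S.proj (X x)) := by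
  rw [divAlong, (ha.fun_smul hX.hasFDerivAt).fderiv, ContinuousLinearMap.comp_add]
  have : ((S.proj ∘L a'.smulRight (X x) : E →L[ℝ] E) : E →ₗ[ℝ] E)
      = (a' : E →ₗ[ℝ] ℝ).smulRight (S.proj (X x)) := by
    ext v; simp
  rw [ContinuousLinearMap.toLinearMap_add, map_add, this, LinearMap.trace_smulRight]
  simp [divAlong]

theorem divAlong_sub_const (S : Gr m E) (p x : E) : divAlong S (fun z => z - p) x = m := by
  have h : fderiv ℝ (fun z : E => z - p) x = ContinuousLinearMap.id ℝ E :=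
    ((hasFDerivAt_id x).sub_const p).fderiv
  rw [divAlong_eq_sum S (stdOrthonormalBasis ℝ S.1), h]
  simp [norm_orthonormalBasis_coe, S.2]

theorem hasFDerivAt_norm_sub_sq {E : Type*} [NormedAddCommGroup E] [InnerProductSpace ℝ E]
    (p z : E) :
    HasFDerivAt (fun z => ‖z - p‖ ^ 2) ((2 : ℝ) • innerSL ℝ (z - p)) z := by
  have := ((hasFDerivAt_id z).sub_const p).norm_sq
  simpa [← Nat.cast_smul_eq_nsmul ℝ] using this

end Divergence

/-! ### Truncated fundamental solution -/

section Kernel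

/-- A nonincreasing smooth cutoff on the line, from `1` on `(-∞, R / 2]` to `0` on `[R, ∞)`. -/
theorem exists_cutoff {R : ℝ} (hR : 0 < R) :
    ∃ χ : ℝ → ℝ, ContDiff ℝ ∞ χ ∧ (∀ t, 0 ≤ χ t) ∧ (∀ t ≤ R / 2, χ t = 1) ∧
      (∀ t, R ≤ t → χ t = 0) ∧ (∀ t, deriv χ t ≤ 0) ∧
      (∀ t < R / 2, deriv χ t = 0) ∧ (∀ t > R, deriv χ t = 0) ∧
      ∃ K, 0 ≤ K ∧ ∀ t, |deriv χ t| ≤ K := by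
  set χ : ℝ → ℝ := fun t => Real.smoothTransition (2 - 2 * t / R) with hχ
  have hsm : ContDiff ℝ ∞ χ :=
    Real.smoothTransition.contDiff.comp (by fun_prop)
  have h1 : ∀ t ≤ R / 2, χ t = 1 := fun t ht => Real.smoothTransition.one_of_one_le (by
    have : 2 * t / R ≤ 1 := by rw [div_le_one hR]; linarith
    linarith)
  have h0 : ∀ t, R ≤ t → χ t = 0 := fun t ht => Real.smoothTransition.zero_of_nonpos (by
    have : 2 ≤ 2 * t / R := by rw [le_div_iff₀ hR]; linarith
    linarith)
  have hanti : Antitone χ := fun a b hab => Real.smoothTransition.monotone (by gcongr)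
  have hd1 : ∀ t < R / 2, deriv χ t = 0 := fun t ht => by
    have : χ =ᶠ[𝓝 t] fun _ => 1 := by
      filter_upwards [Iio_mem_nhds ht] with x hx using h1 x (le_of_lt hx)
    rw [this.deriv_eq]; simp
  have hd0 : ∀ t > R, deriv χ t = 0 := fun t ht => by
    have : χ =ᶠ[𝓝 t] fun _ => 0 := by
      filter_upwards [Ioi_mem_nhds ht] with x hx using h0 x (le_of_lt hx)
    rw [this.deriv_eq]; simp
  refine ⟨χ, hsm, fun t => Real.smoothTransition.nonneg _, h1, h0, fun t => hanti.deriv_nonpos,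
    hd1, hd0, ?_⟩
  have hcont : Continuous (deriv χ) := hsm.continuous_deriv (by simp)
  obtain ⟨K, hK⟩ := (isCompact_Icc (a := R / 2) (b := R)).exists_bound_of_continuousOn
    hcont.continuousOn
  refine ⟨max K 0, le_max_right _ _, fun t => ?_⟩
  rcases lt_or_ge t (R / 2) with h | h
  · simp [hd1 t h]
  rcases lt_or_ge R t with h' | h'
  · simp [hd0 t h']
  exact (hK t ⟨h, h'⟩).trans (le_max_left _ _)

/-- A regularized and truncated fundamental solution of the Laplacian of `ℝ^m`, as a function `Φ`
of `t = |x|²` with `Φ' = -η`: in the sense of `-Δ = 2mη + 4tη'`, it is superharmonic up to a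
bounded error and `-Δ` is at least of order `σ^{-m}` for `|x| ≤ σ`. -/
theorem exists_radial_kernel (m : ℕ) {ρ : ℝ} (hρ : 0 < ρ) :
    ∃ K : ℝ, 0 ≤ K ∧ ∀ σ : ℝ, 0 < σ → 2 * σ ^ 2 ≤ ρ ^ 2 → ∃ η Φ : ℝ → ℝ,
      ContDiff ℝ ∞ η ∧ ContDiff ℝ ∞ Φ ∧ (∀ t, HasDerivAt Φ (-η t) t) ∧
      (∀ t, ρ ^ 2 ≤ t → η t = 0) ∧ (∀ t, ρ ^ 2 ≤ t → Φ t = 0) ∧ (∀ t, 0 ≤ Φ t) ∧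
      (∀ t, 0 ≤ t → deriv η t ≤ 0) ∧
      (∀ t, 0 ≤ t → -K ≤ 2 * m * η t + 4 * t * deriv η t) ∧
      (∀ t, 0 ≤ t → t ≤ σ ^ 2 →
        m * (2 : ℝ) ^ (-(m / 4 : ℝ)) / σ ^ m ≤ 2 * m * η t + 4 * t * deriv η t) := by
  set R := ρ ^ 2 with hRdef
  have hR : 0 < R := by positivity
  obtain ⟨χ, hsm, hχ0, hχ1, hχR, hχd, hχd1, hχdR, K, hK0, hK⟩ := exists_cutoff hR
  -- The only negative contribution comes from the derivative of the cutoff. It lives on `[R / 2,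
  -- R]`, where the kernel is bounded independently of `σ`.
  refine ⟨4 * R * ((R / 2) ^ 2) ^ (-(m / 4 : ℝ)) * K, by positivity, fun σ hσ hσR => ?_⟩
  set s := σ ^ 2 with hs
  have hs0 : 0 < s := by positivity
  have hpos : ∀ t : ℝ, 0 < t ^ 2 + s ^ 2 := fun t => by positivity
  -- With `t = |x|²` this regularizes `|x|^(-m)`, the radial factor in the gradient of the
  -- fundamental solution. Starting from the gradient and integrating afterwards treats all `m`
  -- alike, without a logarithm for `m = 2`.
  set w : ℝ → ℝ := fun t => (t ^ 2 + s ^ 2) ^ (-(m / 4 : ℝ)) with hw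
  set W : ℝ → ℝ := fun t => (t ^ 2 + s ^ 2) ^ (-(m / 4 : ℝ) - 1) with hW
  have hwW : ∀ t, w t = (t ^ 2 + s ^ 2) * W t := fun t => by
    simp only [hw, hW]
    rw [Real.rpow_sub_one (hpos t).ne']
    field_simp [(hpos t).ne']
  have hWpos : ∀ t, 0 < W t := fun t => Real.rpow_pos_of_pos (hpos t) _
  have hwpos : ∀ t, 0 < w t := fun t => Real.rpow_pos_of_pos (hpos t) _
  have hwsm : ContDiff ℝ ∞ w :=
    ContDiff.rpow_const_of_ne (by fun_prop) fun t => (hpos t).ne'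
  have hwd : ∀ t, HasDerivAt w (-(m / 2) * t * W t) t := fun t => by
    have h1 : HasDerivAt (fun t : ℝ => t ^ 2 + s ^ 2) (2 * t) t := by
      simpa using (hasDerivAt_pow 2 t).add_const (s ^ 2)
    have := h1.rpow_const (p := -(m / 4 : ℝ)) (Or.inl (hpos t).ne')
    convert this using 1
    simp only [hW]; ring
  set η : ℝ → ℝ := fun t => w t * χ t with hη
  have hηsm : ContDiff ℝ ∞ η := hwsm.mul hsm
  have hηd : ∀ t, deriv η t = -(m / 2) * t * W t * χ t + w t * deriv χ t := fun t =>
    ((hwd t).mul ((hsm.differentiable (by simp)) t).hasDerivAt).deriv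
  have hηnn : ∀ t, 0 ≤ η t := fun t => mul_nonneg (hwpos t).le (hχ0 t)
  have hηR : ∀ t, R ≤ t → η t = 0 := fun t ht => by simp [hη, hχR t ht]
  -- Since `|x|^(-m) x` is divergence free away from the origin, the terms in `t ^ 2` cancel; only
  -- the regularization `s ^ 2` and the cutoff survive.
  have hkey : ∀ t, 2 * m * η t + 4 * t * deriv η t
      = 2 * m * s ^ 2 * W t * χ t + 4 * t * w t * deriv χ t := fun t => by
    rw [hηd]
    have : η t = w t * χ t := rfl
    rw [this, hwW]; ring
  set Φ : ℝ → ℝ := fun t => ∫ u in t..R, η u with hΦ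
  have hΦd : ∀ t, HasDerivAt Φ (-η t) t := fun t =>
    intervalIntegral.integral_hasDerivAt_left (hηsm.continuous.intervalIntegrable _ _)
      (hηsm.continuous.stronglyMeasurableAtFilter _ _) hηsm.continuous.continuousAt
  refine ⟨η, Φ, hηsm, ?_, hΦd, hηR, ?_, ?_, ?_, ?_, ?_⟩
  · rw [contDiff_infty_iff_deriv]
    refine ⟨fun t => (hΦd t).differentiableAt, ?_⟩
    have : deriv Φ = fun t => -η t := funext fun t => (hΦd t).deriv
    rw [this]; exact hηsm.neg
  · intro t ht
    simp only [hΦ]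
    rw [intervalIntegral.integral_congr (g := fun _ => 0)]
    · simp
    · intro u hu
      rw [uIcc_of_ge ht] at hu
      exact hηR u hu.1
  · intro t
    rcases le_total t R with h | h
    · exact intervalIntegral.integral_nonneg h fun u _ => hηnn u
    · simp only [hΦ]
      rw [intervalIntegral.integral_congr (g := fun _ => 0)]
      · simp
      · intro u hu
        rw [uIcc_of_ge h] at hu
        exact hηR u hu.1
  · intro t ht
    rw [hηd]
    have h1 : 0 ≤ m / 2 * t * W t * χ t := by
      have := hWpos t; have := hχ0 t; positivity
    have h2 : w t * deriv χ t ≤ 0 := mul_nonpos_of_nonneg_of_nonpos (hwpos t).le (hχd t)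
    linarith
  · intro t ht
    rw [hkey]
    have h1 : 0 ≤ 2 * m * s ^ 2 * W t * χ t := by
      have := hWpos t; have := hχ0 t; positivity
    have h2 : -(4 * R * ((R / 2) ^ 2) ^ (-(m / 4 : ℝ)) * K) ≤ 4 * t * w t * deriv χ t := by
      rcases lt_or_ge t (R / 2) with h | h
      · rw [hχd1 t h, mul_zero, neg_nonpos]; positivity
      rcases lt_or_ge R t with h' | h'
      · rw [hχdR t h', mul_zero, neg_nonpos]; positivity
      have h3 : w t ≤ ((R / 2) ^ 2) ^ (-(m / 4 : ℝ)) := by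
        refine Real.rpow_le_rpow_of_nonpos (by positivity) ?_ (by
          have : (0 : ℝ) ≤ m / 4 := by positivity
          linarith)
        have : (R / 2) ^ 2 ≤ t ^ 2 := by gcongr
        nlinarith [sq_nonneg s]
      have h4 : 4 * t * w t * -deriv χ t ≤ 4 * R * ((R / 2) ^ 2) ^ (-(m / 4 : ℝ)) * K := by
        have h5 : -deriv χ t ≤ K := (neg_le_abs _).trans (hK t)
        have h6 : 0 ≤ -deriv χ t := by linarith [hχd t]
        have := (hwpos t).le
        gcongr
      linarith
    linarith
  · intro t ht hts
    rw [hkey, hχ1 t (by linarith)]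
    -- The endpoint `t = R / 2` occurs when `2 * σ ^ 2 = ρ ^ 2`; there the derivative vanishes by
    -- continuity.
    have h1 : deriv χ t = 0 ∨ t = R / 2 := by
      rcases lt_or_ge t (R / 2) with h | h
      · exact Or.inl (hχd1 t h)
      · exact Or.inr (by linarith)
    have h2 : deriv χ t = 0 := by
      rcases h1 with h | h
      · exact h
      · have hcont : Continuous (deriv χ) := hsm.continuous_deriv (by simp)
        have hcl : closure (Iio (R / 2)) ⊆ {x | deriv χ x = 0} :=
          closure_minimal (fun x hx => hχd1 x hx) (isClosed_eq hcont continuous_const)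
        rw [closure_Iio] at hcl
        exact hcl (show t ∈ Iic (R / 2) from h.le)
    rw [h2, mul_zero, add_zero, mul_one]
    have h3 : (2 * s ^ 2) ^ (-(m / 4 : ℝ) - 1) ≤ W t := by
      refine Real.rpow_le_rpow_of_nonpos (hpos t) ?_ (by
          have : (0 : ℝ) ≤ m / 4 := by positivity
          linarith)
      have : t ^ 2 ≤ s ^ 2 := by gcongr
      linarith
    have h4 : m * (2 : ℝ) ^ (-(m / 4 : ℝ)) / σ ^ m
        = 2 * m * s ^ 2 * (2 * s ^ 2) ^ (-(m / 4 : ℝ) - 1) := by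
      rw [Real.rpow_sub_one (by positivity), Real.mul_rpow (by norm_num) (by positivity)]
      have : (s ^ 2) ^ (-(m / 4 : ℝ)) = (σ ^ m)⁻¹ := by
        rw [hs, ← pow_mul, ← Real.rpow_natCast σ (2 * 2), ← Real.rpow_mul hσ.le,
          ← Real.rpow_natCast σ m, ← Real.rpow_neg hσ.le]
        congr 1; push_cast; ring
      rw [this]
      field_simp
    rw [h4]
    gcongr

end Kernel

/-! ### Mean value inequality on stationary varifolds -/

section MeanValue

variable {E : Type*} [NormedAddCommGroup E] [InnerProductSpace ℝ E] [FiniteDimensional ℝ E]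
  {m : ℕ}

instance : BorelSpace (Gr m E) := ⟨rfl⟩

theorem Gr.continuous_proj : Continuous (Gr.proj : Gr m E → E →L[ℝ] E) :=
  continuous_induced_dom

instance : SecondCountableTopology (Gr m E) :=
  TopologicalSpace.secondCountableTopology_induced _ (E →L[ℝ] E) Gr.proj

theorem Gr.norm_proj_le (S : Gr m E) : ‖S.proj‖ ≤ 1 := S.1.starProjection_norm_le

theorem continuous_divAlong {X : E → E} (hX : ContDiff ℝ 1 X) :
    Continuous fun q : E × Gr m E => divAlong q.2 X q.1 := by
  have h : (fun q : E × Gr m E => divAlong q.2 X q.1) = fun q =>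
      ∑ i, ⟪stdOrthonormalBasis ℝ E i,
        q.2.proj (fderiv ℝ X q.1 (stdOrthonormalBasis ℝ E i))⟫ := by
    ext q
    rw [divAlong, LinearMap.trace_eq_sum_inner _ (stdOrthonormalBasis ℝ E)]
    rfl
  rw [h]
  have h1 : Continuous fun q : E × Gr m E => q.2.proj := Gr.continuous_proj.comp continuous_snd
  have h2 : Continuous fun q : E × Gr m E => fderiv ℝ X q.1 :=
    (hX.continuous_fderiv (by simp)).comp continuous_fst
  fun_prop

theorem abs_divAlong_le (S : Gr m E) (X : E → E) (x : E) :
    |divAlong S X x| ≤ Module.finrank ℝ E * ‖fderiv ℝ X x‖ := by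
  set b := stdOrthonormalBasis ℝ E
  rw [divAlong, LinearMap.trace_eq_sum_inner _ b]
  calc |∑ i, ⟪b i, S.proj (fderiv ℝ X x (b i))⟫| ≤ ∑ i, ‖fderiv ℝ X x‖ := by
        refine (Finset.abs_sum_le_sum_abs _ _).trans (Finset.sum_le_sum fun i _ => ?_)
        refine (abs_real_inner_le_norm _ _).trans ?_
        have h1 : ‖b i‖ = 1 := b.orthonormal.1 i
        rw [h1, one_mul]
        refine (S.proj.le_of_opNorm_le S.norm_proj_le _).trans ?_
        rw [one_mul]
        simpa [h1] using (fderiv ℝ X x).le_opNorm (b i)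
    _ = _ := by simp

variable [MeasurableSpace E] [BorelSpace E]

theorem integrable_divAlong {U : Set E} {V : Measure (E × Gr m E)} (hV : IsVarifold U V)
    {X : E → E} (hX : ContDiff ℝ 1 X) (hc : HasCompactSupport X) (hXU : tsupport X ⊆ U) :
    Integrable (fun q : E × Gr m E => divAlong q.2 X q.1) V := by
  have hcont := continuous_divAlong (m := m) hX
  obtain ⟨K, hK⟩ := (hX.continuous_fderiv (by simp)).norm.bounded_above_of_compact_support
    (hc.fderiv ℝ).norm
  rw [← integrableOn_iff_integrable_of_support_subset (s := tsupport X ×ˢ univ)]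
  · refine Measure.integrableOn_of_bounded (M := Module.finrank ℝ E * K) (hV.2 _ hXU hc).ne
      hcont.measurable.aestronglyMeasurable (Eventually.of_forall fun q => ?_)
    refine (abs_divAlong_le _ _ _).trans ?_
    gcongr
    simpa using hK q.1
  · intro q hq
    refine ⟨?_, mem_univ _⟩
    by_contra h
    refine hq ?_
    have : fderiv ℝ X q.1 = 0 := by
      by_contra h'
      exact h (support_fderiv_subset ℝ h')
    simp [divAlong, this]

theorem weight_lt_top {U K : Set E} {V : Measure (E × Gr m E)} (hV : IsVarifold U V)
    (hK : IsCompact K) (hKU : K ⊆ U) : weight V K < ⊤ := by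
  rw [weight, Measure.map_apply measurable_fst hK.measurableSet, ← prod_univ]
  exact hV.2 K hKU hK

/-- The local mean value inequality, before passing to the limit `σ → 0`, for a nonnegative
function `h` with gradient `Y` whose tangential Laplacian is nonnegative on every plane. -/
theorem exists_mean_value_bound (m : ℕ) (hm : 1 ≤ m) {ρ : ℝ} (hρ : 0 < ρ) :
    ∃ K : ℝ, 0 ≤ K ∧ ∀ {U : Set E} {V : Measure (E × Gr m E)}, IsOpen U → IsVarifold U V →
      IsStationary U V → ∀ {p : E}, Metric.closedBall p ρ ⊆ U → ∀ {h : E → ℝ} {Y : E → E},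
      ContDiffOn ℝ ∞ h U → ContDiffOn ℝ ∞ Y U → (∀ z ∈ U, HasFDerivAt h (innerSL ℝ (Y z)) z) →
      (∀ z ∈ Metric.closedBall p ρ, 0 ≤ h z) →
      (∀ z ∈ Metric.closedBall p ρ, ∀ S : Gr m E, 0 ≤ divAlong S Y z) →
      ∀ σ : ℝ, 0 < σ → 2 * σ ^ 2 ≤ ρ ^ 2 →
        ∫ z in Metric.closedBall p σ, h z ∂(weight V)
          ≤ K * σ ^ m * ∫ z in Metric.closedBall p ρ, h z ∂(weight V) := by
  obtain ⟨K, hK0, hK⟩ := exists_radial_kernel m hρ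
  set c : ℝ := m * (2 : ℝ) ^ (-(m / 4 : ℝ)) with hc
  have hc0 : 0 < c := by
    have : (0 : ℝ) < m := by exact_mod_cast hm
    positivity
  refine ⟨K / c, by positivity, ?_⟩
  intro U V hU hV hstat p hpU h Y hh hY hhY hnn hdiv σ hσ hσρ
  obtain ⟨η, Φ, hηsm, hΦsm, hΦd, hηR, hΦR, hΦ0, hηd, hlow, hhigh⟩ := hK σ hσ hσρ
  set t : E → ℝ := fun z => ‖z - p‖ ^ 2 with ht
  have htsm : ContDiff ℝ ∞ t := (contDiff_id.sub contDiff_const).norm_sq ℝ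
  have htd : ∀ z, HasFDerivAt t ((2 : ℝ) • innerSL ℝ (z - p)) z := hasFDerivAt_norm_sub_sq p
  have hball : ∀ z, z ∉ Metric.closedBall p ρ → ρ ^ 2 < t z := by
    intro z hz
    rw [Metric.mem_closedBall, dist_eq_norm, not_le] at hz
    simp only [ht]; gcongr
  -- The gradient of `Φ(|z - p|²)` is `-2 η (z - p)`, so this is the Green field `Φ ∇h - h ∇Φ`.
  set X : E → E := fun z => Φ (t z) • Y z + (2 * (h z * η (t z))) • (z - p) with hX
  have hXsupp : tsupport X ⊆ Metric.closedBall p ρ := by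
    refine closure_minimal (fun z hz => ?_) Metric.isClosed_closedBall
    by_contra hzb
    refine hz ?_
    simp [hX, hηR _ (hball z hzb).le, hΦR _ (hball z hzb).le]
  have hXc : HasCompactSupport X :=
    HasCompactSupport.of_support_subset_isCompact (isCompact_closedBall p ρ)
      ((subset_tsupport X).trans hXsupp)
  have hXsm : ContDiff ℝ ∞ X := by
    rw [contDiff_iff_contDiffAt]
    intro z
    by_cases hz : z ∈ U
    · have h1 : ContDiffAt ℝ ∞ h z := hh.contDiffAt (hU.mem_nhds hz)
      have h2 : ContDiffAt ℝ ∞ Y z := hY.contDiffAt (hU.mem_nhds hz)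
      have h3 : ContDiffAt ℝ ∞ (fun z => Φ (t z)) z := (hΦsm.comp htsm).contDiffAt
      have h4 : ContDiffAt ℝ ∞ (fun z => η (t z)) z := (hηsm.comp htsm).contDiffAt
      exact (h3.smul h2).add ((contDiffAt_const.mul (h1.mul h4)).smul
        (contDiffAt_id.sub contDiffAt_const))
    · have : X =ᶠ[𝓝 z] fun _ => 0 :=
        notMem_tsupport_iff_eventuallyEq.1 fun h' => hz (hpU (hXsupp h'))
      exact contDiffAt_const.congr_of_eventuallyEq this
  have hdivX : ∀ z ∈ U, ∀ S : Gr m E, divAlong S X z = Φ (t z) * divAlong S Y z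
      + h z * (2 * m * η (t z) + 4 * ⟪z - p, S.proj (z - p)⟫ * deriv η (t z)) := by
    intro z hz S
    have hYd : DifferentiableAt ℝ Y z :=
      (hY.contDiffAt (hU.mem_nhds hz)).differentiableAt (by simp)
    have hΦt : HasFDerivAt (fun z => Φ (t z)) (-η (t z) • (2 : ℝ) • innerSL ℝ (z - p)) z :=
      (hΦd (t z)).comp_hasFDerivAt z (htd z)
    have hηt : HasFDerivAt (fun z => η (t z)) (deriv η (t z) • (2 : ℝ) • innerSL ℝ (z - p)) z :=
      ((hηsm.differentiable (by simp)) (t z)).hasDerivAt.comp_hasFDerivAt z (htd z)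
    have hb : HasFDerivAt (fun z => 2 * (h z * η (t z))) _ z :=
      ((hhY z hz).mul hηt).const_mul 2
    have hid : DifferentiableAt ℝ (fun z => z - p) z := by fun_prop
    simp only [hX]
    rw [divAlong_add S (hΦt.differentiableAt.fun_smul hYd) (hb.differentiableAt.fun_smul hid),
      divAlong_smul S hΦt hYd, divAlong_smul S hb hid, divAlong_sub_const]
    -- Symmetry of the projection cancels the two mixed terms, as in Green's formula.
    have hsym : ⟪Y z, S.proj (z - p)⟫ = ⟪z - p, S.proj (Y z)⟫ := by
      rw [← S.inner_proj, real_inner_comm]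
    simp only [_root_.smul_apply, _root_.add_apply, innerSL_apply_apply,
      smul_eq_mul, hsym]
    ring
  have hproj : ∀ (S : Gr m E) (v : E), ⟪v, S.proj v⟫ ≤ ‖v‖ ^ 2 := by
    intro S v
    refine (real_inner_le_norm _ _).trans ?_
    have := S.proj.le_of_opNorm_le S.norm_proj_le v
    rw [one_mul] at this
    nlinarith [norm_nonneg v]
  -- A minorant of the divergence that does not depend on the plane, so its integral against `V` is
  -- an integral against the weight.
  set l : E → ℝ := fun z => (Metric.closedBall p σ).indicator (fun z => c / σ ^ m * h z) z
    - (Metric.closedBall p ρ).indicator (fun z => K * h z) z with hl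
  have hσρ' : σ ≤ ρ := by
    refine le_of_sq_le_sq ?_ hρ.le
    nlinarith [sq_nonneg σ]
  have hpt : ∀ z, ∀ S : Gr m E, l z ≤ divAlong S X z := by
    intro z S
    by_cases hz : z ∈ Metric.closedBall p ρ
    · have hzU := hpU hz
      rw [hdivX z hzU S]
      have h1 : 0 ≤ Φ (t z) * divAlong S Y z := mul_nonneg (hΦ0 _) (hdiv z hz S)
      have ht0 : 0 ≤ t z := sq_nonneg _
      -- The kernel estimates are for the radial direction lying in `S`. This is the worst case,
      -- because `η' ≤ 0` and projecting `z - p` shortens it.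
      have h2 : 2 * m * η (t z) + 4 * t z * deriv η (t z)
          ≤ 2 * m * η (t z) + 4 * ⟪z - p, S.proj (z - p)⟫ * deriv η (t z) := by
        have h3 := hproj S (z - p)
        have h4 := hηd _ ht0
        have : t z * deriv η (t z) ≤ ⟪z - p, S.proj (z - p)⟫ * deriv η (t z) :=
          mul_le_mul_of_nonpos_right h3 h4
        linarith
      have hz0 := hnn z hz
      have h5 := mul_le_mul_of_nonneg_left h2 hz0
      have h6 := mul_le_mul_of_nonneg_left (hlow _ ht0) hz0
      simp only [hl, indicator_of_mem hz]
      by_cases hzσ : z ∈ Metric.closedBall p σ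
      · rw [indicator_of_mem hzσ]
        have hts : t z ≤ σ ^ 2 := by
          rw [Metric.mem_closedBall, dist_eq_norm] at hzσ
          simp only [ht]; gcongr
        have h7 := mul_le_mul_of_nonneg_left (hhigh _ ht0 hts) hz0
        have h8 : 0 ≤ K * h z := mul_nonneg hK0 hz0
        rw [mul_comm (h z) (c / σ ^ m)] at h7
        linarith
      · rw [indicator_of_notMem hzσ]
        linarith
    · have hzσ : z ∉ Metric.closedBall p σ := fun h' =>
        hz (Metric.closedBall_subset_closedBall hσρ' h')
      simp only [hl, indicator_of_notMem hz, indicator_of_notMem hzσ, sub_zero]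
      have : fderiv ℝ X z = 0 := by
        by_contra h'
        exact hz (hXsupp (support_fderiv_subset ℝ h'))
      simp [divAlong, this]
  have hint : ∀ {r : ℝ}, r ≤ ρ → IntegrableOn h (Metric.closedBall p r) (weight V) := by
    intro r hr
    have hsub := (Metric.closedBall_subset_closedBall hr).trans hpU
    have hco : ContinuousOn h (Metric.closedBall p r) := hh.continuousOn.mono hsub
    exact hco.integrableOn_of_subset_isCompact (isCompact_closedBall p r)
      Metric.isClosed_closedBall.measurableSet subset_rfl
      (weight_lt_top hV (isCompact_closedBall p r) hsub).ne
  have hint1 : Integrable ((Metric.closedBall p σ).indicator fun z => c / σ ^ m * h z) (weight V) :=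
    (integrable_indicator_iff Metric.isClosed_closedBall.measurableSet).2
      ((hint hσρ').const_mul _)
  have hint2 : Integrable ((Metric.closedBall p ρ).indicator fun z => K * h z) (weight V) :=
    (integrable_indicator_iff Metric.isClosed_closedBall.measurableSet).2
      ((hint le_rfl).const_mul _)
  have hlint : Integrable l (weight V) := hint1.sub hint2
  have hle : ∫ z, l z ∂(weight V) ≤ 0 := by
    rw [← hstat X hXsm hXc (hXsupp.trans hpU)]
    have hl2 : Integrable (fun q : E × Gr m E => l q.1) V := hlint.comp_measurable measurable_fst
    rw [weight, integral_map measurable_fst.aemeasurable hlint.aestronglyMeasurable]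
    exact integral_mono hl2
      (integrable_divAlong hV (hXsm.of_le (by simp)) hXc (hXsupp.trans hpU)) fun q => hpt q.1 q.2
  simp only [hl] at hle
  rw [integral_sub hint1 hint2, integral_indicator Metric.isClosed_closedBall.measurableSet,
    integral_indicator Metric.isClosed_closedBall.measurableSet, integral_const_mul,
    integral_const_mul, sub_nonpos] at hle
  have hσm : 0 < σ ^ m := by positivity
  rw [div_mul_eq_mul_div, div_le_iff₀ hσm] at hle
  rw [div_mul_eq_mul_div, div_mul_eq_mul_div, le_div_iff₀ hc0]
  linarith

end MeanValue

/-! ### Lower density and the limit of shrinking balls -/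

section Density

variable {E : Type*} [NormedAddCommGroup E] [InnerProductSpace ℝ E] [FiniteDimensional ℝ E]
  [MeasurableSpace E] [BorelSpace E] {m : ℕ}

/-- The integral over an `m`-plane of the standard radial hat function. -/
def hatIntegral (m : ℕ) : ℝ := ∫ x : EuclideanSpace ℝ (Fin m), max 0 (1 - ‖x‖)

theorem hasCompactSupport_hat (F : Type*) [NormedAddCommGroup F] [ProperSpace F] :
    HasCompactSupport fun x : F => max 0 (1 - ‖x‖) := by
  refine HasCompactSupport.of_support_subset_isCompact (isCompact_closedBall (0 : F) 1) ?_
  intro x hx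
  rw [mem_closedBall_zero_iff]
  by_contra h
  exact hx (max_eq_left (by linarith))

theorem hatIntegral_pos (m : ℕ) : 0 < hatIntegral m := by
  have hc : Continuous fun x : EuclideanSpace ℝ (Fin m) => max 0 (1 - ‖x‖) := by fun_prop
  exact hc.integral_pos_of_hasCompactSupport_nonneg_nonzero (hasCompactSupport_hat _)
    (fun x => le_max_left _ _) (x := 0) (by simp)

/-- A linear isometry from `ℝ^m` onto the plane carries Lebesgue measure to `μHE[m]`, so the
constant is the same for all planes. -/
theorem setIntegral_hat (S : Gr m E) :
    ∫ y in (S.1 : Set E), max 0 (1 - ‖y‖) ∂μHE[m] = hatIntegral m := by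
  set f : EuclideanSpace ℝ (Fin m) →ₗᵢ[ℝ] E := S.1.subtypeₗᵢ.comp
    ((stdOrthonormalBasis ℝ S.1).reindex (finCongr S.2)).repr.symm.toLinearIsometry with hf
  have hrange : range f = (S.1 : Set E) := by
    rw [hf]
    ext y
    constructor
    · rintro ⟨x, rfl⟩
      simp
    · intro hy
      refine ⟨((stdOrthonormalBasis ℝ S.1).reindex (finCongr S.2)).repr ⟨y, hy⟩, ?_⟩
      simp
  rw [← hrange, ← f.isometry.map_euclideanHausdorffMeasure,
    EuclideanSpace.euclideanHausdorffMeasure_eq_volume,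
    integral_map f.continuous.measurable.aemeasurable (by fun_prop)]
  simp [hatIntegral]

/-- The lower density bound at points where the approximate tangent plane exists. -/
theorem IsApproxTangent.eventually_le_measure {A : Set E} {x : E} {S : Gr m E}
    (h : IsApproxTangent A x S) : ∀ᶠ r in 𝓝[>] (0 : ℝ),
      ENNReal.ofReal (hatIntegral m / 2 * r ^ m)
        ≤ (μHE[m] : Measure E).restrict A (Metric.closedBall x r) := by
  -- The hat function lies below the indicator of the unit ball, so its rescaled integrals bound the
  -- mass of small balls from below. They eventually exceed half of their positive limit.
  have hlim := h (fun y => max 0 (1 - ‖y‖)) (by fun_prop) (hasCompactSupport_hat E)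
  rw [setIntegral_hat] at hlim
  have hpos := hatIntegral_pos m
  filter_upwards [hlim.eventually (lt_mem_nhds (half_lt_self hpos)), self_mem_nhdsWithin]
    with r hr hr0
  have hr0 : 0 < r := hr0
  have hrm : 0 < r ^ m := by positivity
  rw [inv_mul_eq_div, lt_div_iff₀ hrm] at hr
  refine (ENNReal.ofReal_le_ofReal hr.le).trans ?_
  rw [integral_eq_lintegral_of_nonneg_ae (f := fun y => max 0 (1 - ‖r⁻¹ • (y - x)‖))
    (Eventually.of_forall fun y => le_max_left _ _)
    (by fun_prop)]
  refine ENNReal.ofReal_toReal_le.trans ?_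
  rw [← lintegral_indicator_one Metric.isClosed_closedBall.measurableSet]
  refine lintegral_mono fun y => ?_
  by_cases hy : y ∈ Metric.closedBall x r
  · rw [indicator_of_mem hy]
    refine ENNReal.ofReal_le_one.2 (max_le zero_le_one ?_)
    linarith [norm_nonneg (r⁻¹ • (y - x))]
  · rw [indicator_of_notMem hy, nonpos_iff_eq_zero, ENNReal.ofReal_eq_zero]
    rw [Metric.mem_closedBall, dist_eq_norm, not_le] at hy
    rw [norm_smul, norm_inv, Real.norm_of_nonneg hr0.le, max_le_iff]
    refine ⟨le_rfl, ?_⟩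
    have : 1 ≤ r⁻¹ * ‖y - x‖ := by
      rw [inv_mul_eq_div, le_div_iff₀ hr0]; linarith
    linarith

/-- Multiplicities are at least one, so the weight dominates `μHE[m]` on the carrying set and
inherits its density bound. Integrality thus keeps the constant independent of `V`. -/
theorem IsIntegralVarifold.ae_density {U : Set E} {V : Measure (E × Gr m E)}
    (hV : IsIntegralVarifold U V) : ∀ᵐ x ∂(weight V), ∀ᶠ r in 𝓝[>] (0 : ℝ),
      ENNReal.ofReal (hatIntegral m / 2 * r ^ m) ≤ weight V (Metric.closedBall x r) := by
  obtain ⟨-, A, Θ, T, -, -, -, -, hΘ1, hw, -, hT, -⟩ := hV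
  filter_upwards [hT] with x hx
  filter_upwards [hx.eventually_le_measure] with r hr
  refine hr.trans ?_
  rw [hw, withDensity_apply _ Metric.isClosed_closedBall.measurableSet, ← setLIntegral_one]
  refine lintegral_mono_ae ((ae_restrict_of_ae hΘ1).mono fun y hy => ?_)
  exact_mod_cast hy

/-- Passing to the limit in a mean value inequality at a point of positive lower density. -/
theorem le_of_mean_value_of_density {E : Type*} [NormedAddCommGroup E] [MeasurableSpace E]
    [BorelSpace E] {μ : Measure E} {h : E → ℝ} {p : E} {c K I σ₀ : ℝ}
    (hc : 0 < c) (hKI : 0 ≤ K * I) (hσ₀ : 0 < σ₀) (hcont : ContinuousAt h p)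
    (hint : ∀ σ, 0 < σ → σ ≤ σ₀ → IntegrableOn h (Metric.closedBall p σ) μ)
    (hfin : ∀ σ, 0 < σ → σ ≤ σ₀ → μ (Metric.closedBall p σ) ≠ ⊤)
    (hdens : ∀ᶠ r in 𝓝[>] (0 : ℝ), ENNReal.ofReal (c * r ^ m) ≤ μ (Metric.closedBall p r))
    (hmv : ∀ σ, 0 < σ → σ ≤ σ₀ → ∫ z in Metric.closedBall p σ, h z ∂μ ≤ K * σ ^ m * I) :
    h p ≤ K * I / c := by
  refine le_of_forall_pos_le_add fun ε hε => ?_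
  rcases le_or_gt (h p) ε with hpe | hpe
  · have : 0 ≤ K * I / c := by positivity
    linarith
  have h1 : ∀ᶠ z in 𝓝 p, h p - ε < h z := hcont.eventually (lt_mem_nhds (by linarith))
  obtain ⟨r, hr, hr1⟩ := Metric.eventually_nhds_iff_ball.1 h1
  have h2 : ∀ᶠ σ in 𝓝[>] (0 : ℝ), σ < min r σ₀ :=
    nhdsWithin_le_nhds (gt_mem_nhds (lt_min hr hσ₀))
  obtain ⟨σ, ⟨hσd, hσ⟩, hσ0⟩ := ((hdens.and h2).and self_mem_nhdsWithin).exists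
  have hσ0 : 0 < σ := hσ0
  have hσr : σ < r := hσ.trans_le (min_le_left _ _)
  have hσσ : σ ≤ σ₀ := hσ.le.trans (min_le_right _ _)
  have h3 := hmv σ hσ0 hσσ
  have h4 : (h p - ε) * μ.real (Metric.closedBall p σ)
      ≤ ∫ z in Metric.closedBall p σ, h z ∂μ := by
    refine setIntegral_ge_of_const_le_real Metric.isClosed_closedBall.measurableSet (hfin σ hσ0 hσσ)
      (fun z hz => ?_) (hint σ hσ0 hσσ)
    exact (hr1 z (Metric.closedBall_subset_ball hσr hz)).le
  have h5 : c * σ ^ m ≤ μ.real (Metric.closedBall p σ) :=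
    (ENNReal.ofReal_le_iff_le_toReal (hfin σ hσ0 hσσ)).1 hσd
  have h6 : (h p - ε) * (c * σ ^ m) ≤ K * σ ^ m * I :=
    -- The powers `σ ^ m` of the density bound and of the mean value inequality match and cancel.
    ((mul_le_mul_of_nonneg_left h5 (by linarith)).trans h4).trans h3
  have h7 : (h p - ε) * c ≤ K * I := by
    have : 0 < σ ^ m := by positivity
    nlinarith
  have := (le_div_iff₀ hc).2 h7
  linarith

end Density

/-! ### Graphs: smoothness and tangent planes -/

section Graph

theorem injective_of_hasFDerivAt_leftInverse {F G : Type*} [NormedAddCommGroup F]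
    [NormedSpace ℝ F] [NormedAddCommGroup G] [NormedSpace ℝ G] {Φ : F → G} {Ψ : G → F} {p : F}
    {A : F →L[ℝ] G} {B : G →L[ℝ] F} (hΦ : HasFDerivAt Φ A p) (hΨ : HasFDerivAt Ψ B (Φ p))
    (h : ∀ᶠ z in 𝓝 p, Ψ (Φ z) = z) : Function.Injective A := by
  have hcomp : HasFDerivAt (fun z => Ψ (Φ z)) (B ∘L A) p := hΨ.comp p hΦ
  have hid : HasFDerivAt (fun z => Ψ (Φ z)) (ContinuousLinearMap.id ℝ F) p :=
    (hasFDerivAt_id p).congr_of_eventuallyEq h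
  have heq : B ∘L A = ContinuousLinearMap.id ℝ F := hcomp.unique hid
  refine Function.LeftInverse.injective (g := B) fun v => ?_
  simpa using congrArg (fun A => A v) heq

/-- If a diffeomorphism `Φ` straightens the graph of a differentiable function `g` near a point,
then `g` is smooth there. The ambient space `F` is a product `X × Y` with projections `π₁`, `π₂`
and pairing `ι`. -/
theorem contDiffAt_of_graph_straightened {X Y F : Type*} [NormedAddCommGroup X] [NormedSpace ℝ X]
    [NormedAddCommGroup Y] [NormedSpace ℝ Y] [NormedAddCommGroup F] [NormedSpace ℝ F]
    [FiniteDimensional ℝ X] [FiniteDimensional ℝ F] (π₁ : F →L[ℝ] X) (π₂ : F →L[ℝ] Y)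
    (ι : X × Y →L[ℝ] F) (hι₁ : ∀ q, π₁ (ι q) = q.1) (hι₂ : ∀ q, π₂ (ι q) = q.2)
    (hι : ∀ z, ι (π₁ z, π₂ z) = z) {g : X → Y} {x : X} (hg : DifferentiableAt ℝ g x)
    {Φ Φs : F → F} (hΦ : ContDiffAt ℝ ∞ Φ (ι (x, g x)))
    (hΦs : ContDiffAt ℝ ∞ Φs (Φ (ι (x, g x)))) (hinv : ∀ᶠ z in 𝓝 (ι (x, g x)), Φs (Φ z) = z)
    (hzero : ∀ᶠ y in 𝓝 x, π₂ (Φ (ι (y, g y))) = 0) : ContDiffAt ℝ ∞ g x := by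
  have : CompleteSpace F := FiniteDimensional.complete ℝ F
  have hext : ∀ {z w : F}, π₁ z = π₁ w → π₂ z = π₂ w → z = w := fun {z w} h1 h2 => by
    rw [← hι z, ← hι w, h1, h2]
  have hγ : HasFDerivAt (fun y => ι (y, g y))
      (ι ∘L (ContinuousLinearMap.id ℝ X).prod (fderiv ℝ g x)) x :=
    ι.hasFDerivAt.comp x ((hasFDerivAt_id x).prodMk hg.hasFDerivAt)
  set γ' := ι ∘L (ContinuousLinearMap.id ℝ X).prod (fderiv ℝ g x) with hγ'
  have hγ'1 : ∀ a, π₁ (γ' a) = a := fun a => by simp [hγ', hι₁]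
  set p := ι (x, g x) with hp
  have hΦd : HasFDerivAt Φ (fderiv ℝ Φ p) p := (hΦ.differentiableAt (by simp)).hasFDerivAt
  have hinj : Function.Injective (fderiv ℝ Φ p) := injective_of_hasFDerivAt_leftInverse hΦd
    (hΦs.differentiableAt (by simp)).hasFDerivAt hinv
  have htan : ∀ a, π₂ (fderiv ℝ Φ p (γ' a)) = 0 := by
    intro a
    have h1 : HasFDerivAt (fun y => π₂ (Φ (ι (y, g y)))) (π₂ ∘L (fderiv ℝ Φ p ∘L γ')) x :=
      π₂.hasFDerivAt.comp x (hΦd.comp x hγ)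
    have h2 : HasFDerivAt (fun y => π₂ (Φ (ι (y, g y)))) (0 : X →L[ℝ] Y) x :=
      (hasFDerivAt_const 0 x).congr_of_eventuallyEq hzero
    simpa using congrArg (fun A => A a) (h1.unique h2)
  -- Keeping the base point and replacing the vertical coordinate by the defining function of the
  -- graph gives a map to which the inverse function theorem applies; its inverse on `(y, 0)`
  -- recovers `g`.
  set Ψ : F → F := fun z => ι (π₁ z, π₂ (Φ z)) with hΨ
  set Ψ' : F →L[ℝ] F := ι ∘L (π₁.prod (π₂ ∘L fderiv ℝ Φ p)) with hΨ'
  have hΨd : HasFDerivAt Ψ Ψ' p := ι.hasFDerivAt.comp p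
    (π₁.hasFDerivAt.prodMk (π₂.hasFDerivAt.comp p hΦd))
  have hΨsm : ContDiffAt ℝ ∞ Ψ p := ι.contDiff.contDiffAt.comp p
    (π₁.contDiff.contDiffAt.prodMk (π₂.contDiff.contDiffAt.comp p hΦ))
  have hΨinj : Function.Injective Ψ' := by
    rw [injective_iff_map_eq_zero]
    intro v hv
    have hv1 : π₁ v = 0 := by simpa [hΨ', hι₁] using congrArg π₁ hv
    have hv2 : π₂ (fderiv ℝ Φ p v) = 0 := by simpa [hΨ', hι₂] using congrArg π₂ hv
    -- The derivative of `Φ` sends the tangent space of the graph injectively into `X × 0`, hence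
    -- onto it by dimension. A vector killed by `π₂ ∘ DΦ` is therefore tangent, and a tangent vector
    -- with zero horizontal part vanishes.
    set A : X →L[ℝ] X := π₁ ∘L (fderiv ℝ Φ p ∘L γ') with hA
    have hAinj : Function.Injective (A : X →ₗ[ℝ] X) := by
      rw [injective_iff_map_eq_zero]
      intro a ha
      have h3 : fderiv ℝ Φ p (γ' a) = fderiv ℝ Φ p 0 := by
        refine hext ?_ ?_
        · rw [map_zero, map_zero]; exact ha
        · rw [map_zero, map_zero]; exact htan a
      rw [← hγ'1 a, hinj h3, map_zero]
    obtain ⟨a, ha⟩ := (LinearMap.injective_iff_surjective.1 hAinj) (π₁ (fderiv ℝ Φ p v))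
    have h4 : γ' a = v := hinj (hext ha ((htan a).trans hv2.symm))
    have h5 : a = 0 := by rw [← hv1, ← h4, hγ'1]
    rw [← h4, h5, map_zero]
  set e : F ≃L[ℝ] F :=
    (LinearEquiv.ofInjectiveEndo (Ψ' : F →ₗ[ℝ] F) hΨinj).toContinuousLinearEquiv with he
  have heΨ : (e : F →L[ℝ] F) = Ψ' := by ext v; rfl
  have hΨe : HasFDerivAt Ψ (e : F →L[ℝ] F) p := by rwa [heΨ]
  have hn0 : (∞ : WithTop ℕ∞) ≠ 0 := by simp
  have hsm := hΨsm.to_localInverse hΨe hn0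
  have hleft : ∀ᶠ z in 𝓝 p, hΨsm.localInverse hΨe hn0 (Ψ z) = z :=
    (hΨsm.hasStrictFDerivAt' hΨe hn0).eventually_left_inverse
  have hΨγ : ∀ y, π₂ (Φ (ι (y, g y))) = 0 → Ψ (ι (y, g y)) = ι (y, 0) := fun y hy => by
    simp only [hΨ, hy, hι₁]
  have hev : g =ᶠ[𝓝 x] fun y => π₂ (hΨsm.localInverse hΨe hn0 (ι (y, 0))) := by
    filter_upwards [hγ.continuousAt.eventually hleft, hzero] with y hy hy0
    rw [← hΨγ y hy0, hy, hι₂]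
  refine ContDiffAt.congr_of_eventuallyEq ?_ hev
  rw [hΨγ x hzero.self_of_nhds] at hsm
  exact π₂.contDiff.contDiffAt.comp x (hsm.comp x
    (ι.contDiff.contDiffAt.comp x (contDiffAt_id.prodMk contDiffAt_const)))

theorem continuousSMul_of_normedSpace (F : Type*) [NormedAddCommGroup F] [NormedSpace ℝ F] :
    ContinuousSMul ℝ F := inferInstance

instance (m n : ℕ) : ContinuousSMul ℝ (Space m n) := continuousSMul_of_normedSpace _

variable {m n : ℕ}

/-- The projection of `ℝ^m × ℝ^n` onto the first factor. -/
def fstCLM (m n : ℕ) : Space m n →L[ℝ] EuclideanSpace ℝ (Fin m) := WithLp.fstL 2 ℝ _ _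

/-- The projection of `ℝ^m × ℝ^n` onto the second factor. -/
def sndCLM (m n : ℕ) : Space m n →L[ℝ] EuclideanSpace ℝ (Fin n) := WithLp.sndL 2 ℝ _ _

/-- The pairing map onto `ℝ^m × ℝ^n`. -/
def pairCLM (m n : ℕ) : EuclideanSpace ℝ (Fin m) × EuclideanSpace ℝ (Fin n) →L[ℝ] Space m n :=
  ((WithLp.prodContinuousLinearEquiv 2 ℝ (EuclideanSpace ℝ (Fin m))
    (EuclideanSpace ℝ (Fin n))).symm : _ →L[ℝ] Space m n)

@[simp] theorem fstCLM_apply (z : Space m n) : fstCLM m n z = z.fst := rfl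

@[simp] theorem sndCLM_apply (z : Space m n) : sndCLM m n z = z.snd := rfl

/-- The point of the graph of `g` over `x`. -/
def graphPt (g : EuclideanSpace ℝ (Fin m) → EuclideanSpace ℝ (Fin n))
    (x : EuclideanSpace ℝ (Fin m)) : Space m n := WithLp.toLp 2 (x, g x)

@[simp] theorem graphPt_fst (g : EuclideanSpace ℝ (Fin m) → EuclideanSpace ℝ (Fin n))
    (x : EuclideanSpace ℝ (Fin m)) : (graphPt g x).fst = x := rfl

@[simp] theorem graphPt_snd (g : EuclideanSpace ℝ (Fin m) → EuclideanSpace ℝ (Fin n))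
    (x : EuclideanSpace ℝ (Fin m)) : (graphPt g x).snd = g x := rfl

/-- The inclusion of the second factor in `ℝ^m × ℝ^n`. -/
def inrPt (m : ℕ) {n : ℕ} (b : EuclideanSpace ℝ (Fin n)) : Space m n := WithLp.toLp 2 (0, b)

@[simp] theorem inrPt_fst (b : EuclideanSpace ℝ (Fin n)) : (inrPt m b).fst = 0 := rfl

@[simp] theorem inrPt_snd (b : EuclideanSpace ℝ (Fin n)) : (inrPt m b).snd = b := rfl

theorem norm_inrPt (b : EuclideanSpace ℝ (Fin n)) : ‖inrPt m b‖ = ‖b‖ :=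
  WithLp.norm_toLp_snd 2 _ _ b

theorem space_ext {z w : Space m n} (h1 : z.fst = w.fst) (h2 : z.snd = w.snd) : z = w :=
  WithLp.ofLp_injective 2 (Prod.ext h1 h2)

/-- The linear map `a ↦ (a, L a)`. -/
def graphCLM (L : EuclideanSpace ℝ (Fin m) →L[ℝ] EuclideanSpace ℝ (Fin n)) :
    EuclideanSpace ℝ (Fin m) →L[ℝ] Space m n :=
  pairCLM m n ∘L ((ContinuousLinearMap.id ℝ (EuclideanSpace ℝ (Fin m))).prod L)

@[simp] theorem graphCLM_fst (L : EuclideanSpace ℝ (Fin m) →L[ℝ] EuclideanSpace ℝ (Fin n))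
    (a : EuclideanSpace ℝ (Fin m)) : (graphCLM L a).fst = a := rfl

@[simp] theorem graphCLM_snd (L : EuclideanSpace ℝ (Fin m) →L[ℝ] EuclideanSpace ℝ (Fin n))
    (a : EuclideanSpace ℝ (Fin m)) : (graphCLM L a).snd = L a := rfl

/-- The graph of a linear map `ℝ^m → ℝ^n` as a linear subspace. -/
def graphPlane (L : EuclideanSpace ℝ (Fin m) →L[ℝ] EuclideanSpace ℝ (Fin n)) :
    Submodule ℝ (Space m n) := 
  LinearMap.range (graphCLM L : EuclideanSpace ℝ (Fin m) →ₗ[ℝ] Space m n)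

theorem mem_graphPlane {L : EuclideanSpace ℝ (Fin m) →L[ℝ] EuclideanSpace ℝ (Fin n)}
    {v : Space m n} : v ∈ graphPlane L ↔ v.snd = L v.fst := by
  constructor
  · rintro ⟨a, rfl⟩; rfl
  · intro h
    exact ⟨v.fst, space_ext rfl h.symm⟩

theorem finrank_graphPlane (L : EuclideanSpace ℝ (Fin m) →L[ℝ] EuclideanSpace ℝ (Fin n)) :
    Module.finrank ℝ (graphPlane L) = m := by
  have hinj : Function.Injective (graphCLM L : EuclideanSpace ℝ (Fin m) →ₗ[ℝ] Space m n) :=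
    fun a b h => by simpa using congrArg (fun z : Space m n => z.fst) h
  rw [graphPlane, LinearMap.finrank_range_of_inj hinj]
  simp

theorem hasFDerivAt_graphPt {g : EuclideanSpace ℝ (Fin m) → EuclideanSpace ℝ (Fin n)}
    {g' : EuclideanSpace ℝ (Fin m) →L[ℝ] EuclideanSpace ℝ (Fin n)}
    {x : EuclideanSpace ℝ (Fin m)} (hg : HasFDerivAt g g' x) :
    HasFDerivAt (graphPt g) (graphCLM g') x :=
  (pairCLM m n).hasFDerivAt.comp x ((hasFDerivAt_id x).prodMk hg)

theorem isOpen_cyl (r : ℝ) : IsOpen (cyl m n r) :=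
  isOpen_lt (fstCLM m n).continuous.norm continuous_const

/-- The normal component of a vector is controlled by its distance from the graph measured
vertically. -/
theorem norm_starProjection_graphPlane_orthogonal_le
    (L : EuclideanSpace ℝ (Fin m) →L[ℝ] EuclideanSpace ℝ (Fin n)) (v : Space m n) :
    ‖(graphPlane L)ᗮ.starProjection v‖ ≤ ‖v.snd - L v.fst‖ := by
  have h1 : v = graphCLM L v.fst + inrPt m (v.snd - L v.fst) :=
    space_ext (by simp) (by simp)
  have h2 : (graphPlane L)ᗮ.starProjection (graphCLM L v.fst) = 0 :=
    Submodule.starProjection_orthogonal_apply_eq_zero ⟨v.fst, rfl⟩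
  conv_lhs => rw [h1, map_add, h2, zero_add]
  exact (Submodule.norm_starProjection_apply_le _ _).trans (norm_inrPt _).le

/-- A plane of slope at most `1/2` is far from vertical: if `w` is the projection of a vertical
vector `(0, b)` onto it, then `|w|² = ⟨w^y, b⟩ ≤ |w| |b| / 2`. So at least half of the vector is
normal. -/
theorem half_norm_le_norm_starProjection_inrPt
    {L : EuclideanSpace ℝ (Fin m) →L[ℝ] EuclideanSpace ℝ (Fin n)} (hL : ‖L‖ ≤ 1 / 2)
    (b : EuclideanSpace ℝ (Fin n)) :
    ‖b‖ ≤ 2 * ‖(graphPlane L)ᗮ.starProjection (inrPt m b)‖ := by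
  set u := inrPt m b with hu
  set w := (graphPlane L).starProjection u with hw
  have hwm : w.snd = L w.fst := mem_graphPlane.1 (Submodule.starProjection_apply_mem _ _)
  have h1 : ‖w‖ ^ 2 = ⟪w, u⟫ := by
    rw [← real_inner_self_eq_norm_sq]
    conv_lhs => rw [hw, Submodule.inner_starProjection_left_eq_right,
      Submodule.starProjection_eq_self_iff.2 (Submodule.starProjection_apply_mem _ _)]
    rw [real_inner_comm]
  have h2 : ⟪w, u⟫ = ⟪w.snd, b⟫ := by
    rw [WithLp.prod_inner_apply]
    simp [hu]
  have h3 : ⟪w.snd, b⟫ ≤ 1 / 2 * ‖w‖ * ‖b‖ := by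
    refine (real_inner_le_norm _ _).trans ?_
    gcongr
    rw [hwm]
    refine (L.le_of_opNorm_le hL _).trans ?_
    gcongr
    exact WithLp.norm_fst_le (p := 2) (β := EuclideanSpace ℝ (Fin n)) _ w
  have h4 : ‖w‖ ≤ 1 / 2 * ‖b‖ := by
    rcases (norm_nonneg w).eq_or_lt with h | h
    · rw [← h]; positivity
    · nlinarith
  have h5 : u = w + (graphPlane L)ᗮ.starProjection u :=
    (Submodule.starProjection_add_starProjection_orthogonal u).symm
  have h6 : ‖u‖ ≤ ‖w‖ + ‖(graphPlane L)ᗮ.starProjection u‖ := by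
    conv_lhs => rw [h5]
    exact norm_add_le _ _
  rw [hu, norm_inrPt] at h6
  linarith

variable {M : Set (Space m n)} {g : EuclideanSpace ℝ (Fin m) → EuclideanSpace ℝ (Fin n)} {r : ℝ}

theorem graphPt_mem (hM : M ∩ cyl m n r = {z | z.fst ∈ Metric.ball 0 r ∧ z.snd = g z.fst})
    {x : EuclideanSpace ℝ (Fin m)} (hx : x ∈ Metric.ball 0 r) : graphPt g x ∈ M := by
  have : graphPt g x ∈ M ∩ cyl m n r := by rw [hM]; exact ⟨hx, rfl⟩
  exact this.1

/-- A `C^1` function whose graph is a `C^∞` submanifold is `C^∞`. -/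
theorem contDiffOn_of_isSmoothSubmanifold (hM : IsSmoothSubmanifold M)
    (hMg : M ∩ cyl m n r = {z | z.fst ∈ Metric.ball 0 r ∧ z.snd = g z.fst})
    (hg : DifferentiableOn ℝ g (Metric.ball 0 r)) : ContDiffOn ℝ ∞ g (Metric.ball 0 r) := by
  intro x hx
  refine ContDiffAt.contDiffWithinAt ?_
  have hnhds : Metric.ball 0 r ∈ 𝓝 x := Metric.isOpen_ball.mem_nhds hx
  have hgd : DifferentiableAt ℝ g x := hg.differentiableAt hnhds
  obtain ⟨Φ, hpΦ, hΦ, hΦs, hΦM⟩ := hM _ (graphPt_mem hMg hx)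
  have hγ := hasFDerivAt_graphPt hgd.hasFDerivAt
  refine contDiffAt_of_graph_straightened (fstCLM m n) (sndCLM m n) (pairCLM m n)
    (Φ := Φ) (Φs := Φ.symm) (fun _ => rfl) (fun _ => rfl) (fun _ => rfl) hgd
    (hΦ.contDiffAt (Φ.open_source.mem_nhds hpΦ))
    (hΦs.contDiffAt (Φ.open_target.mem_nhds (Φ.map_source hpΦ)))
    (Φ.eventually_left_inverse hpΦ) ?_
  filter_upwards [hγ.continuousAt.eventually (Φ.open_source.mem_nhds hpΦ), hnhds] with y hy hyr
  exact (hΦM _ hy).1 (graphPt_mem hMg hyr)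

/-- The map `y - g(x)` is zero on the graph, so its derivative kills tangent directions, `{0}`
having only the zero tangent vector. Conversely, differentiating the graph map yields every vector
`(a, Dg a)`. -/
theorem tangentPlane_eq_graphPlane
    (hM : M ∩ cyl m n r = {z | z.fst ∈ Metric.ball 0 r ∧ z.snd = g z.fst})
    (hg : DifferentiableOn ℝ g (Metric.ball 0 r)) {x : EuclideanSpace ℝ (Fin m)}
    (hx : x ∈ Metric.ball 0 r) : tangentPlane M (graphPt g x) = graphPlane (fderiv ℝ g x) := by
  have hnhds : Metric.ball 0 r ∈ 𝓝 x := Metric.isOpen_ball.mem_nhds hx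
  have hgd : HasFDerivAt g (fderiv ℝ g x) x := (hg.differentiableAt hnhds).hasFDerivAt
  have hcyl : cyl m n r ∈ 𝓝 (graphPt g x) :=
    (isOpen_cyl r).mem_nhds (by simpa [cyl] using hx)
  apply le_antisymm
  · rw [tangentPlane, Submodule.span_le]
    intro v hv
    rw [← tangentConeAt_inter_nhds hcyl] at hv
    have hF : HasFDerivAt (fun z : Space m n => z.snd - g z.fst)
        (sndCLM m n - fderiv ℝ g x ∘L fstCLM m n) (graphPt g x) :=
      (sndCLM m n).hasFDerivAt.sub
        (HasFDerivAt.comp (graphPt g x) (f := fstCLM m n) (g := g) hgd (fstCLM m n).hasFDerivAt)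
    have h1 := hF.hasFDerivWithinAt.mapsTo_tangent_cone hv
    have h2 : (fun z : Space m n => z.snd - g z.fst) '' (M ∩ cyl m n r) ⊆ {0} := by
      rw [hM]
      rintro _ ⟨z, hz, rfl⟩
      simp [hz.2]
    have hacc : ¬AccPt ((graphPt g x).snd - g (graphPt g x).fst)
        (𝓟 ({0} : Set (EuclideanSpace ℝ (Fin n)))) := by
      intro h
      obtain ⟨y, ⟨-, hy⟩, hne⟩ := accPt_iff_nhds.1 h univ univ_mem
      exact hne (by simpa using hy)
    have h3 := tangentConeAt_subset_zero (𝕜 := ℝ) hacc (tangentConeAt_mono h2 h1)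
    rw [SetLike.mem_coe, mem_graphPlane]
    have h4 : v.snd - fderiv ℝ g x v.fst = 0 := h3
    exact sub_eq_zero.1 h4
  · rintro _ ⟨a, rfl⟩
    refine Submodule.subset_span ?_
    have h1 : a ∈ tangentConeAt ℝ (Metric.ball 0 r) x := by
      have : tangentConeAt ℝ (Metric.ball 0 r) x = univ := by
        rw [← univ_inter (Metric.ball 0 r), tangentConeAt_inter_nhds hnhds, tangentConeAt_univ]
      rw [this]; trivial
    refine tangentConeAt_mono ?_ ((hasFDerivAt_graphPt hgd).hasFDerivWithinAt.mapsTo_tangent_cone h1)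
    rintro _ ⟨y, hy, rfl⟩
    exact graphPt_mem hM hy

end Graph

/-! ### Second fundamental form and Hessian traces -/

section Curvature

variable {m n : ℕ} {M : Set (Space m n)}
  {g : EuclideanSpace ℝ (Fin m) → EuclideanSpace ℝ (Fin n)} {r : ℝ}

theorem eq_graphPt_of_mem
    (hM : M ∩ cyl m n r = {z | z.fst ∈ Metric.ball 0 r ∧ z.snd = g z.fst})
    {q : Space m n} (hq : q ∈ M) (hqr : q ∈ cyl m n r) :
    q.fst ∈ Metric.ball 0 r ∧ q = graphPt g q.fst := by
  have h : q ∈ {z : Space m n | z.fst ∈ Metric.ball 0 r ∧ z.snd = g z.fst} := hM ▸ ⟨hq, hqr⟩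
  exact ⟨h.1, space_ext rfl h.2⟩

/-- The second fundamental form of a graph is the normal part of `(0, D²g)`. -/
theorem secondFundamentalForm_graph
    (hM : M ∩ cyl m n r = {z | z.fst ∈ Metric.ball 0 r ∧ z.snd = g z.fst})
    (hg : ContDiffOn ℝ 2 g (Metric.ball 0 r)) {x : EuclideanSpace ℝ (Fin m)}
    (hx : x ∈ Metric.ball 0 r) {v w : Space m n} (hv : v ∈ tangentPlane M (graphPt g x))
    (hw : w ∈ tangentPlane M (graphPt g x)) :
    secondFundamentalForm M (graphPt g x) v w =
      (tangentPlane M (graphPt g x))ᗮ.starProjection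
        (inrPt m (fderiv ℝ (fderiv ℝ g) x v.fst w.fst)) := by
  have hgd : DifferentiableOn ℝ g (Metric.ball 0 r) := hg.differentiableOn (by simp)
  have hnhds : Metric.ball 0 r ∈ 𝓝 x := Metric.isOpen_ball.mem_nhds hx
  have hgx : HasFDerivAt g (fderiv ℝ g x) x := (hgd.differentiableAt hnhds).hasFDerivAt
  have hT := tangentPlane_eq_graphPlane hM hgd hx
  have hg1 : ContDiffAt ℝ 1 (fderiv ℝ g) x := (hg.contDiffAt hnhds).fderiv_right (by norm_num)
  have hg2 : HasFDerivAt (fderiv ℝ g) (fderiv ℝ (fderiv ℝ g) x) x :=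
    (hg1.differentiableAt (by simp)).hasFDerivAt
  have hγ := hasFDerivAt_graphPt hgx
  have hcyl : cyl m n r ∈ 𝓝 (graphPt g x) :=
    (isOpen_cyl r).mem_nhds (by simpa [cyl] using hx)
  have hex : ∃ W, IsTangentExtension M (graphPt g x) w W := by
    -- Freeze the horizontal part of `w` and lift it to the tangent plane over each base point.
    refine ⟨fun z => pairCLM m n (w.fst, fderiv ℝ g z.fst w.fst), ?_, ?_, ?_⟩
    · have h1 : ContDiffAt ℝ 1 (fun z : Space m n => fderiv ℝ g z.fst) (graphPt g x) :=
        ContDiffAt.comp (graphPt g x) (g := fderiv ℝ g) (f := fstCLM m n) hg1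
          (fstCLM m n).contDiff.contDiffAt
      exact (pairCLM m n).contDiff.contDiffAt.comp _
        (contDiffAt_const.prodMk (h1.clm_apply contDiffAt_const))
    · rw [hT, mem_graphPlane] at hw
      exact space_ext rfl hw.symm
    · filter_upwards [self_mem_nhdsWithin, nhdsWithin_le_nhds hcyl] with q hq hqr
      obtain ⟨h1, h2⟩ := eq_graphPt_of_mem hM hq hqr
      have h3 : tangentPlane M q = graphPlane (fderiv ℝ g q.fst) := by
        conv_lhs => rw [h2]
        exact tangentPlane_eq_graphPlane hM hgd h1
      rw [h3, mem_graphPlane]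
      rfl
  rw [secondFundamentalForm, dif_pos hex]
  obtain ⟨hW1, hW2, hW3⟩ := hex.choose_spec
  set W := hex.choose
  have hWd : HasFDerivAt W (fderiv ℝ W (graphPt g x)) (graphPt g x) :=
    (hW1.differentiableAt (by simp)).hasFDerivAt
  have htend : Tendsto (graphPt g) (𝓝 x) (𝓝[M] (graphPt g x)) := by
    refine tendsto_nhdsWithin_iff.2 ⟨hγ.continuousAt, ?_⟩
    filter_upwards [hnhds] with y hy using graphPt_mem hM hy
  -- Differentiating the tangency relation `W^y = Dg(W^x)` along the graph shows that `D_v W` is a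
  -- tangent vector plus `(0, D²g(v, w))`. Its normal part is thus the same for every extension, in
  -- particular the chosen one.
  have hev : (fun y => sndCLM m n (W (graphPt g y))) =ᶠ[𝓝 x]
      fun y => fderiv ℝ g y (fstCLM m n (W (graphPt g y))) := by
    filter_upwards [htend.eventually hW3, hnhds] with y hy hyr
    rw [tangentPlane_eq_graphPlane hM hgd hyr, mem_graphPlane] at hy
    exact hy
  have hWγ := hWd.comp x hγ
  have h1 : HasFDerivAt (fun y => sndCLM m n (W (graphPt g y)))
      (sndCLM m n ∘L (fderiv ℝ W (graphPt g x) ∘L graphCLM (fderiv ℝ g x))) x :=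
    (sndCLM m n).hasFDerivAt.comp x hWγ
  have h2 : HasFDerivAt (fun y => fstCLM m n (W (graphPt g y)))
      (fstCLM m n ∘L (fderiv ℝ W (graphPt g x) ∘L graphCLM (fderiv ℝ g x))) x :=
    (fstCLM m n).hasFDerivAt.comp x hWγ
  have h3 := (hg2.clm_apply h2).congr_of_eventuallyEq hev
  have h4 := congrArg (fun A => A v.fst) (h1.unique h3)
  have hv' : graphCLM (fderiv ℝ g x) v.fst = v := by
    rw [hT, mem_graphPlane] at hv
    exact space_ext rfl hv.symm
  simp only [ContinuousLinearMap.comp_apply, _root_.add_apply, hv', sndCLM_apply, fstCLM_apply,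
    ContinuousLinearMap.flip_apply, hW2] at h4
  have h5 : fderiv ℝ W (graphPt g x) v
      = graphCLM (fderiv ℝ g x) (fderiv ℝ W (graphPt g x) v).fst
        + inrPt m (fderiv ℝ (fderiv ℝ g) x v.fst w.fst) :=
    space_ext (by simp) (by simpa using h4)
  have h6 : (tangentPlane M (graphPt g x))ᗮ.starProjection
      (graphCLM (fderiv ℝ g x) (fderiv ℝ W (graphPt g x) v).fst) = 0 :=
    Submodule.starProjection_orthogonal_apply_eq_zero (by rw [hT]; exact ⟨_, rfl⟩)
  rw [h5, map_add, h6, zero_add]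

/-- The mean curvature of an almost flat graph controls the trace of the Hessian. -/
theorem norm_sum_hessian_le_meanCurvature
    (hM : M ∩ cyl m n r = {z | z.fst ∈ Metric.ball 0 r ∧ z.snd = g z.fst})
    (hg : ContDiffOn ℝ 2 g (Metric.ball 0 r)) {x : EuclideanSpace ℝ (Fin m)}
    (hx : x ∈ Metric.ball 0 r) (hDg : ‖fderiv ℝ g x‖ ≤ 1 / 2) :
    ‖∑ i, fderiv ℝ (fderiv ℝ g) x
        (stdOrthonormalBasis ℝ (tangentPlane M (graphPt g x)) i : Space m n).fst
        (stdOrthonormalBasis ℝ (tangentPlane M (graphPt g x)) i : Space m n).fst‖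
      ≤ 2 * ‖meanCurvature M (graphPt g x)‖ := by
  have hT := tangentPlane_eq_graphPlane hM (hg.differentiableOn (by simp)) hx
  set b := ∑ i, fderiv ℝ (fderiv ℝ g) x
        (stdOrthonormalBasis ℝ (tangentPlane M (graphPt g x)) i : Space m n).fst
        (stdOrthonormalBasis ℝ (tangentPlane M (graphPt g x)) i : Space m n).fst with hb
  have hsum : ∀ (f : Fin (Module.finrank ℝ (tangentPlane M (graphPt g x))) →
      EuclideanSpace ℝ (Fin n)), ∑ i, inrPt m (f i) = inrPt m (∑ i, f i) := fun f =>
    space_ext (by rw [← fstCLM_apply, map_sum]; simp) (by rw [← sndCLM_apply, map_sum]; simp)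
  have h1 : meanCurvature M (graphPt g x)
      = (tangentPlane M (graphPt g x))ᗮ.starProjection (inrPt m b) := by
    rw [meanCurvature, hb, ← hsum, map_sum]
    refine Finset.sum_congr rfl fun i _ => ?_
    exact secondFundamentalForm_graph hM hg hx (Subtype.coe_prop _) (Subtype.coe_prop _)
  rw [h1, hT]
  exact half_norm_le_norm_starProjection_inrPt hDg b

/-- The trace of `⟨F, D²g⟩` over an arbitrary `m`-plane is controlled by the mean curvature and by
the tilt of the plane with respect to the graph. -/
theorem sum_inner_hessian_le
    (hM : M ∩ cyl m n r = {z | z.fst ∈ Metric.ball 0 r ∧ z.snd = g z.fst})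
    (hg : ContDiffOn ℝ 2 g (Metric.ball 0 r)) {x : EuclideanSpace ℝ (Fin m)}
    (hx : x ∈ Metric.ball 0 r) (hDg : ‖fderiv ℝ g x‖ ≤ 1 / 2) {δ : ℝ}
    (hD2g : 2 * ‖fderiv ℝ (fderiv ℝ g) x‖ ≤ δ) (y : EuclideanSpace ℝ (Fin n))
    (S : Gr m (Space m n)) {κ : Type*} [Fintype κ] (e : OrthonormalBasis κ ℝ S.1) :
    2 * ∑ j, ⟪y, fderiv ℝ (fderiv ℝ g) x (e j : Space m n).fst (e j : Space m n).fst⟫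
      ≤ 4 * ‖y‖ * ‖meanCurvature M (graphPt g x)‖
        + Module.finrank ℝ (Space m n) * δ ^ 2 / 2 * ‖y‖ ^ 2
        + ∑ j, ‖(e j : Space m n).snd - fderiv ℝ g x (e j : Space m n).fst‖ ^ 2 := by
  have hT := tangentPlane_eq_graphPlane hM (hg.differentiableOn (by simp)) hx
  set T := tangentPlane M (graphPt g x) with hTdef
  set e' := stdOrthonormalBasis ℝ T with he'
  set N : ℝ := ((Module.finrank ℝ (Space m n) : ℕ) : ℝ) with hN
  set D := ∑ j, ‖(e j : Space m n).snd - fderiv ℝ g x (e j : Space m n).fst‖ ^ 2 with hD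
  set B : Space m n →ₗ[ℝ] Space m n →ₗ[ℝ] ℝ := LinearMap.mk₂ ℝ
    (fun v w => ⟪y, fderiv ℝ (fderiv ℝ g) x v.fst w.fst⟫)
    (by intro a b c; simp [inner_add_right]) (by intro a b c; simp [inner_smul_right])
    (by intro a b c; simp [inner_add_right]) (by intro a b c; simp [inner_smul_right]) with hB
  have hBapp : ∀ v w, B v w = ⟪y, fderiv ℝ (fderiv ℝ g) x v.fst w.fst⟫ := fun v w => rfl
  have hfst : ∀ v : Space m n, ‖v.fst‖ ≤ ‖v‖ := fun v =>
    WithLp.norm_fst_le (p := 2) (β := EuclideanSpace ℝ (Fin n)) _ v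
  have hδ : 0 ≤ δ := le_trans (by positivity) hD2g
  have hBle : ∀ v w, |B v w| ≤ (‖y‖ * (δ / 2)) * ‖v‖ * ‖w‖ := by
    intro v w
    rw [hBapp]
    refine (abs_real_inner_le_norm _ _).trans ?_
    have h1 : ‖fderiv ℝ (fderiv ℝ g) x v.fst w.fst‖ ≤ δ / 2 * ‖v‖ * ‖w‖ := by
      refine ((fderiv ℝ (fderiv ℝ g) x).le_opNorm₂ _ _).trans ?_
      have h2 : ‖fderiv ℝ (fderiv ℝ g) x‖ ≤ δ / 2 := by linarith
      have := hfst v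
      have := hfst w
      gcongr
    calc ‖y‖ * ‖fderiv ℝ (fderiv ℝ g) x v.fst w.fst‖ ≤ ‖y‖ * (δ / 2 * ‖v‖ * ‖w‖) := by gcongr
      _ = _ := by ring
  have hcard : Fintype.card κ = Fintype.card (Fin (Module.finrank ℝ T)) := by
    rw [← Module.finrank_eq_card_basis e.toBasis, S.2, Fintype.card_fin, hT, finrank_graphPlane]
  have hcmp := abs_sum_bilin_sub_le B hBle e e' hcard
  have hperp : ∑ j, ‖Tᗮ.starProjection (e j : Space m n)‖ ^ 2 ≤ D := by
    refine Finset.sum_le_sum fun j _ => ?_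
    rw [hT]
    gcongr
    exact norm_starProjection_graphPlane_orthogonal_le _ _
  have hD0 : 0 ≤ D := Finset.sum_nonneg fun j _ => sq_nonneg _
  have hN0 : 0 ≤ N := Nat.cast_nonneg _
  have hsq : (‖y‖ * (δ / 2)) * √(N * (2 * ∑ j, ‖Tᗮ.starProjection (e j : Space m n)‖ ^ 2))
      ≤ (‖y‖ * (δ / 2)) * √(N * (2 * D)) := by
    gcongr
  -- Young's inequality is weighted so that exactly one `D` is spent; the second derivative of the
  -- squared height supplies `2D`.
  have hyoung : 2 * ((‖y‖ * (δ / 2)) * √(N * (2 * D))) ≤ N * δ ^ 2 / 2 * ‖y‖ ^ 2 + D := by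
    have h1 : √(N * (2 * D)) = √(2 * N) * √D := by
      rw [← Real.sqrt_mul (by positivity)]; congr 1; ring
    have h2 : √(2 * N) ^ 2 = 2 * N := Real.sq_sqrt (by positivity)
    have h3 : √D ^ 2 = D := Real.sq_sqrt hD0
    rw [h1]
    have h4 := sq_nonneg (‖y‖ * δ * √(2 * N) / 2 - √D)
    rw [show (‖y‖ * δ * √(2 * N) / 2 - √D) ^ 2 = ‖y‖ ^ 2 * δ ^ 2 * √(2 * N) ^ 2 / 4
      - ‖y‖ * δ * √(2 * N) * √D + √D ^ 2 by ring, h2, h3] at h4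
    linarith
  have hH : ∑ j, B (e' j) (e' j) ≤ 2 * ‖y‖ * ‖meanCurvature M (graphPt g x)‖ := by
    simp_rw [hBapp]
    rw [← inner_sum]
    refine (real_inner_le_norm _ _).trans ?_
    have := norm_sum_hessian_le_meanCurvature hM hg hx hDg
    calc _ ≤ ‖y‖ * (2 * ‖meanCurvature M (graphPt g x)‖) := by gcongr
      _ = _ := by ring
  have hfin := (le_abs_self _).trans hcmp
  simp_rw [hBapp (e _ : Space m n)] at hfin
  linarith

end Curvature

/-! ### Gradient fields and their tangential divergence -/

section Height

/-- The gradient of a function, in coordinates with respect to an orthonormal basis. -/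
def gradField {E : Type*} [NormedAddCommGroup E] [InnerProductSpace ℝ E] [FiniteDimensional ℝ E]
    (f : E → ℝ) (z : E) : E :=
  ∑ i, fderiv ℝ f z (stdOrthonormalBasis ℝ E i) • stdOrthonormalBasis ℝ E i

variable {E : Type*} [NormedAddCommGroup E] [InnerProductSpace ℝ E] [FiniteDimensional ℝ E]
  {m : ℕ} {f : E → ℝ}

theorem inner_gradField (f : E → ℝ) (z v : E) : ⟪gradField f z, v⟫ = fderiv ℝ f z v := by
  conv_rhs => rw [← (stdOrthonormalBasis ℝ E).sum_repr' v, map_sum]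
  rw [gradField, sum_inner]
  refine Finset.sum_congr rfl fun i _ => ?_
  rw [real_inner_smul_left, map_smul, smul_eq_mul, mul_comm]

theorem contDiffOn_gradField {U : Set E} (hU : IsOpen U) (hf : ContDiffOn ℝ ∞ f U) :
    ContDiffOn ℝ ∞ (gradField f) U := by
  have h : ContDiffOn ℝ ∞ (fderiv ℝ f) U := hf.fderiv_of_isOpen hU (by simp)
  exact ContDiffOn.sum fun i _ => (h.clm_apply contDiffOn_const).smul contDiffOn_const

theorem divAlong_gradField {κ : Type*} [Fintype κ] (S : Gr m E) (e : OrthonormalBasis κ ℝ S.1)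
    {z : E} (hf : DifferentiableAt ℝ (gradField f) z) :
    divAlong S (gradField f) z = ∑ j, fderiv ℝ (fun w => fderiv ℝ f w (e j)) z (e j) := by
  rw [divAlong_eq_sum S e]
  refine Finset.sum_congr rfl fun j _ => ?_
  have h1 : (fun w => fderiv ℝ f w (e j)) = fun w => ⟪(e j : E), gradField f w⟫ := by
    ext w; rw [real_inner_comm, inner_gradField]
  rw [h1]
  have h2 : HasFDerivAt (fun w => ⟪(e j : E), gradField f w⟫)
      (innerSL ℝ (e j : E) ∘L fderiv ℝ (gradField f) z) z :=
    (innerSL ℝ (e j : E)).hasFDerivAt.comp z hf.hasFDerivAt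
  rw [h2.fderiv]
  rfl

end Height

/-! ### Squared height and the subharmonic barrier -/

section HeightFunction

variable {m n : ℕ} {M : Set (Space m n)}
  {g : EuclideanSpace ℝ (Fin m) → EuclideanSpace ℝ (Fin n)} {r : ℝ}

/-- The squared vertical distance from the graph of `g`. -/
def heightSq (g : EuclideanSpace ℝ (Fin m) → EuclideanSpace ℝ (Fin n)) (z : Space m n) : ℝ :=
  ‖z.snd - g z.fst‖ ^ 2

theorem mem_ball_of_mem_cyl {z : Space m n} (hz : z ∈ cyl m n r) : z.fst ∈ Metric.ball 0 r := by
  simpa [cyl] using hz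

theorem contDiffOn_heightSq (hg : ContDiffOn ℝ ∞ g (Metric.ball 0 r)) :
    ContDiffOn ℝ ∞ (heightSq g) (cyl m n r) := by
  refine ContDiffOn.norm_sq ℝ ((sndCLM m n).contDiff.contDiffOn.sub ?_)
  exact ContDiffOn.comp (g := g) (f := fstCLM m n) hg (fstCLM m n).contDiff.contDiffOn
    fun z hz => mem_ball_of_mem_cyl hz

theorem hasFDerivAt_snd_sub (hg : DifferentiableOn ℝ g (Metric.ball 0 r)) {z : Space m n}
    (hz : z ∈ cyl m n r) : HasFDerivAt (fun z : Space m n => z.snd - g z.fst)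
      (sndCLM m n - fderiv ℝ g z.fst ∘L fstCLM m n) z :=
  (sndCLM m n).hasFDerivAt.sub (HasFDerivAt.comp z (f := fstCLM m n) (g := g)
    (hg.differentiableAt (Metric.isOpen_ball.mem_nhds (mem_ball_of_mem_cyl hz))).hasFDerivAt
    (fstCLM m n).hasFDerivAt)

theorem fderiv_heightSq (hg : DifferentiableOn ℝ g (Metric.ball 0 r)) {z : Space m n}
    (hz : z ∈ cyl m n r) (v : Space m n) :
    fderiv ℝ (heightSq g) z v = 2 * ⟪z.snd - g z.fst, v.snd - fderiv ℝ g z.fst v.fst⟫ := by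
  have h := (hasFDerivAt_snd_sub hg hz).norm_sq
  have h' : HasFDerivAt (heightSq g) _ z := h
  rw [h'.fderiv]
  simp
  rw [inner_sub_left, inner_sub_right, inner_sub_right]
  ring

theorem fderiv_fderiv_heightSq (hg : ContDiffOn ℝ 2 g (Metric.ball 0 r)) {z : Space m n}
    (hz : z ∈ cyl m n r) (v : Space m n) :
    fderiv ℝ (fun w => fderiv ℝ (heightSq g) w v) z v
      = 2 * (‖v.snd - fderiv ℝ g z.fst v.fst‖ ^ 2
        - ⟪z.snd - g z.fst, fderiv ℝ (fderiv ℝ g) z.fst v.fst v.fst⟫) := by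
  have hgd : DifferentiableOn ℝ g (Metric.ball 0 r) := hg.differentiableOn (by simp)
  have hnhds := Metric.isOpen_ball.mem_nhds (mem_ball_of_mem_cyl hz)
  have hg1 : ContDiffAt ℝ 1 (fderiv ℝ g) z.fst := (hg.contDiffAt hnhds).fderiv_right (by norm_num)
  have hg2 : HasFDerivAt (fderiv ℝ g) (fderiv ℝ (fderiv ℝ g) z.fst) z.fst :=
    (hg1.differentiableAt (by simp)).hasFDerivAt
  have hev : (fun w => fderiv ℝ (heightSq g) w v) =ᶠ[𝓝 z] fun w =>
      2 * ⟪w.snd - g w.fst, v.snd - fderiv ℝ g w.fst v.fst⟫ := by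
    filter_upwards [(isOpen_cyl r).mem_nhds hz] with w hw using fderiv_heightSq hgd hw v
  have hA := hasFDerivAt_snd_sub hgd hz
  have hB : HasFDerivAt (fun w : Space m n => v.snd - fderiv ℝ g w.fst v.fst)
      (-((ContinuousLinearMap.apply ℝ (EuclideanSpace ℝ (Fin n)) v.fst) ∘L
        (fderiv ℝ (fderiv ℝ g) z.fst ∘L fstCLM m n))) z :=
    (((ContinuousLinearMap.apply ℝ (EuclideanSpace ℝ (Fin n)) v.fst).hasFDerivAt).comp z
      (HasFDerivAt.comp z (f := fstCLM m n) (g := fderiv ℝ g) hg2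
        (fstCLM m n).hasFDerivAt)).const_sub v.snd
  rw [hev.fderiv_eq, ((hA.inner ℝ hB).const_mul 2).fderiv]
  simp [fderivInnerCLM_apply, inner_neg_right]
  ring

/-- The differential inequality for the squared height over an almost flat graph: the Laplacian
along any `m`-plane is bounded below in terms of the tilt of the plane, the height, and the mean
curvature. -/
theorem divAlong_gradField_heightSq_ge
    (hM : M ∩ cyl m n r = {z | z.fst ∈ Metric.ball 0 r ∧ z.snd = g z.fst})
    (hg : ContDiffOn ℝ ∞ g (Metric.ball 0 r)) {z : Space m n} (hz : z ∈ cyl m n r)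
    (hDg : ‖fderiv ℝ g z.fst‖ ≤ 1 / 2) {δ : ℝ}
    (hD2g : 2 * ‖fderiv ℝ (fderiv ℝ g) z.fst‖ ≤ δ)
    (hδ : Module.finrank ℝ (Space m n) * δ ^ 2 ≤ 1 / 40) {k : ℝ}
    (hk : ‖meanCurvature M (graphPt g z.fst)‖ ≤ k)
    (S : Gr m (Space m n)) {κ : Type*} [Fintype κ] (e : OrthonormalBasis κ ℝ S.1) :
    (∑ j, ‖(e j : Space m n).snd - fderiv ℝ g z.fst (e j : Space m n).fst‖ ^ 2)
        - 3 / 80 * heightSq g z - 160 * k ^ 2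
      ≤ divAlong S (gradField (heightSq g)) z := by
  have hg2 : ContDiffOn ℝ 2 g (Metric.ball 0 r) := contDiffOn_infty.1 hg 2
  have hG : DifferentiableAt ℝ (gradField (heightSq g)) z :=
    ((contDiffOn_gradField (isOpen_cyl r) (contDiffOn_heightSq hg)).contDiffAt
      ((isOpen_cyl r).mem_nhds hz)).differentiableAt (by simp)
  rw [divAlong_gradField S e hG]
  simp_rw [fderiv_fderiv_heightSq hg2 hz]
  rw [← Finset.mul_sum, Finset.sum_sub_distrib]
  have h := sum_inner_hessian_le hM hg2 (mem_ball_of_mem_cyl hz) hDg hD2g (z.snd - g z.fst) S e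
  have hf : heightSq g z = ‖z.snd - g z.fst‖ ^ 2 := rfl
  set F := ‖z.snd - g z.fst‖
  set H := ‖meanCurvature M (graphPt g z.fst)‖
  have hH : 0 ≤ H := norm_nonneg _
  have hF : 0 ≤ F := norm_nonneg _
  -- The `1/40` here and the `1/80` from the tilt comparison below add up to the coefficient `3/80`.
  have h1 : 4 * F * H ≤ F ^ 2 / 40 + 160 * k ^ 2 := by
    have : F * H ≤ F * k := by gcongr
    nlinarith [sq_nonneg (F - 80 * k)]
  have h2 : Module.finrank ℝ (Space m n) * δ ^ 2 / 2 * F ^ 2 ≤ 1 / 80 * F ^ 2 :=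
    mul_le_mul_of_nonneg_right (by linarith) (sq_nonneg F)
  rw [hf]
  linarith

/-- The comparison function: a perturbation of the squared height which is subharmonic along every
`m`-plane. -/
def barrier (g : EuclideanSpace ℝ (Fin m) → EuclideanSpace ℝ (Fin n)) (p : Space m n) (k : ℝ)
    (z : Space m n) : ℝ :=
  (1 + ‖z - p‖ ^ 2 / 16) * heightSq g z + 85 * k ^ 2 * ‖z - p‖ ^ 2

/-- The gradient of `barrier`. -/
def barrierGrad (g : EuclideanSpace ℝ (Fin m) → EuclideanSpace ℝ (Fin n)) (p : Space m n) (k : ℝ)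
    (z : Space m n) : Space m n :=
  (1 + ‖z - p‖ ^ 2 / 16) • gradField (heightSq g) z
    + (heightSq g z / 8 + 170 * k ^ 2) • (z - p)

theorem heightSq_nonneg (z : Space m n) : 0 ≤ heightSq g z := sq_nonneg _

theorem barrier_nonneg (p : Space m n) (k : ℝ) (z : Space m n) : 0 ≤ barrier g p k z := by
  have := heightSq_nonneg (g := g) z
  unfold barrier
  positivity

theorem contDiff_norm_sub_sq (p : Space m n) :
    ContDiff ℝ ∞ fun z : Space m n => ‖z - p‖ ^ 2 :=
  (contDiff_id.sub contDiff_const).norm_sq ℝ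

theorem contDiffOn_barrier (hg : ContDiffOn ℝ ∞ g (Metric.ball 0 r)) (p : Space m n) (k : ℝ) :
    ContDiffOn ℝ ∞ (barrier g p k) (cyl m n r) :=
  ((contDiffOn_const.add ((contDiff_norm_sub_sq p).contDiffOn.div_const 16)).mul
    (contDiffOn_heightSq hg)).add (contDiffOn_const.mul (contDiff_norm_sub_sq p).contDiffOn)

theorem contDiffOn_barrierGrad (hg : ContDiffOn ℝ ∞ g (Metric.ball 0 r)) (p : Space m n) (k : ℝ) :
    ContDiffOn ℝ ∞ (barrierGrad g p k) (cyl m n r) :=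
  ((contDiffOn_const.add ((contDiff_norm_sub_sq p).contDiffOn.div_const 16)).smul
    (contDiffOn_gradField (isOpen_cyl r) (contDiffOn_heightSq hg))).add
    ((((contDiffOn_heightSq hg).div_const 8).add contDiffOn_const).smul
      (contDiffOn_id.sub contDiffOn_const))

theorem hasFDerivAt_heightSq (hg : ContDiffOn ℝ ∞ g (Metric.ball 0 r)) {z : Space m n}
    (hz : z ∈ cyl m n r) :
    HasFDerivAt (heightSq g) (innerSL ℝ (gradField (heightSq g) z)) z := by
  have h : HasFDerivAt (heightSq g) (fderiv ℝ (heightSq g) z) z :=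
    (((contDiffOn_heightSq hg).contDiffAt ((isOpen_cyl r).mem_nhds hz)).differentiableAt
      (by simp)).hasFDerivAt
  refine h.congr_fderiv ?_
  ext v
  exact (inner_gradField (heightSq g) z v).symm

theorem hasFDerivAt_weight (p z : Space m n) :
    HasFDerivAt (fun z : Space m n => 1 + ‖z - p‖ ^ 2 / 16)
      ((1 / 8 : ℝ) • innerSL ℝ (z - p)) z := by
  have h := ((hasFDerivAt_norm_sub_sq p z).mul_const (1 / 16 : ℝ)).const_add 1
  have h1 : (fun z : Space m n => 1 + ‖z - p‖ ^ 2 / 16)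
      = fun z => 1 + ‖z - p‖ ^ 2 * (1 / 16 : ℝ) := by
    ext z; ring
  rw [h1]
  refine h.congr_fderiv ?_
  rw [smul_smul]
  norm_num

theorem hasFDerivAt_barrier (hg : ContDiffOn ℝ ∞ g (Metric.ball 0 r)) (p : Space m n) (k : ℝ)
    {z : Space m n} (hz : z ∈ cyl m n r) :
    HasFDerivAt (barrier g p k) (innerSL ℝ (barrierGrad g p k z)) z := by
  have h := ((hasFDerivAt_weight p z).mul (hasFDerivAt_heightSq hg hz)).add
    ((hasFDerivAt_norm_sub_sq p z).const_mul (85 * k ^ 2))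
  refine HasFDerivAt.congr_fderiv h ?_
  ext v
  simp only [_root_.add_apply, _root_.smul_apply, innerSL_apply_apply, smul_eq_mul, barrierGrad,
    inner_add_left, real_inner_smul_left]
  ring

/-- The mixed term costs at most `D + F²/16`. The quadratic weight gains `F²/8`, which pays for
`F²/16` and for `(17/16)(3/80) F²`. The curvature terms balance exactly: `(17/16) * 160 = 170 = 2 *
85`, whence the `85` in `barrier`. -/
theorem barrier_estimate {t D F k L c a : ℝ} (ht0 : 0 ≤ t) (ht1 : t ≤ 1) (hD0 : 0 ≤ D)
    (hL : D - 3 / 80 * F ^ 2 - 160 * k ^ 2 ≤ L) (hc : |c| ≤ 2 * (F * √D)) (ha : 1 ≤ a) :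
    0 ≤ (1 + t / 16) * L + (F ^ 2 / 8 + 170 * k ^ 2) * a + 1 / 4 * c := by
  have h1 : (1 + t / 16) * (D - 3 / 80 * F ^ 2 - 160 * k ^ 2) ≤ (1 + t / 16) * L := by gcongr
  have h2 : (F ^ 2 / 8 + 170 * k ^ 2) ≤ (F ^ 2 / 8 + 170 * k ^ 2) * a :=
    le_mul_of_one_le_right (by positivity) ha
  have h3 := (abs_le.1 hc).1
  have h4 : √D ^ 2 = D := Real.sq_sqrt hD0
  have h5 : 1 / 2 * (F * √D) ≤ D + F ^ 2 / 16 := by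
    nlinarith [sq_nonneg (F / 4 - √D)]
  have h6 : t / 16 * (3 / 80 * F ^ 2 + 160 * k ^ 2)
      ≤ 1 / 16 * (3 / 80 * F ^ 2 + 160 * k ^ 2) := by gcongr
  have h7 : 0 ≤ t / 16 * D := by positivity
  linarith [sq_nonneg F]

/-- The position field `z - p` has divergence `m ≥ 1` along every plane; this positive gain beats
the errors in the differential inequality for the squared height. -/
theorem divAlong_barrierGrad_nonneg (hm : 1 ≤ m)
    (hM : M ∩ cyl m n r = {z | z.fst ∈ Metric.ball 0 r ∧ z.snd = g z.fst})
    (hg : ContDiffOn ℝ ∞ g (Metric.ball 0 r)) {z : Space m n} (hz : z ∈ cyl m n r)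
    (hDg : ‖fderiv ℝ g z.fst‖ ≤ 1 / 2) {δ : ℝ}
    (hD2g : 2 * ‖fderiv ℝ (fderiv ℝ g) z.fst‖ ≤ δ)
    (hδ : Module.finrank ℝ (Space m n) * δ ^ 2 ≤ 1 / 40) {k : ℝ}
    (hk : ‖meanCurvature M (graphPt g z.fst)‖ ≤ k) {p : Space m n} (hp : ‖z - p‖ ≤ 1)
    (S : Gr m (Space m n)) : 0 ≤ divAlong S (barrierGrad g p k) z := by
  set e := stdOrthonormalBasis ℝ S.1
  have hlap := divAlong_gradField_heightSq_ge hM hg hz hDg hD2g hδ hk S e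
  have hG : DifferentiableAt ℝ (gradField (heightSq g)) z :=
    ((contDiffOn_gradField (isOpen_cyl r) (contDiffOn_heightSq hg)).contDiffAt
      ((isOpen_cyl r).mem_nhds hz)).differentiableAt (by simp)
  have hq := hasFDerivAt_weight p z
  have hb : HasFDerivAt (fun z => heightSq g z / 8 + 170 * k ^ 2)
      ((1 / 8 : ℝ) • innerSL ℝ (gradField (heightSq g) z)) z := by
    have h := ((hasFDerivAt_heightSq hg hz).mul_const (1 / 8 : ℝ)).add_const (170 * k ^ 2)
    have h1 : (fun z => heightSq g z / 8 + 170 * k ^ 2)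
        = fun z => heightSq g z * (1 / 8 : ℝ) + 170 * k ^ 2 := by
      ext z; ring
    rw [h1]
    exact h
  have hid : DifferentiableAt ℝ (fun z => z - p) z := by fun_prop
  have hdiv : divAlong S (barrierGrad g p k) z
      = (1 + ‖z - p‖ ^ 2 / 16) * divAlong S (gradField (heightSq g)) z
        + (heightSq g z / 8 + 170 * k ^ 2) * m
        + 1 / 4 * fderiv ℝ (heightSq g) z (S.proj (z - p)) := by
    unfold barrierGrad
    rw [divAlong_add S (hq.differentiableAt.fun_smul hG) (hb.differentiableAt.fun_smul hid),
      divAlong_smul S hq hG, divAlong_smul S hb hid, divAlong_sub_const]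
    simp only [_root_.smul_apply, innerSL_apply_apply, smul_eq_mul]
    rw [← S.inner_proj, real_inner_comm, inner_gradField]
    ring
  set D := ∑ j, ‖(e j : Space m n).snd - fderiv ℝ g z.fst (e j : Space m n).fst‖ ^ 2 with hD
  have hD0 : 0 ≤ D := Finset.sum_nonneg fun j _ => sq_nonneg _
  set F := ‖z.snd - g z.fst‖ with hF
  have hf : heightSq g z = F ^ 2 := rfl
  have hF0 : 0 ≤ F := norm_nonneg _
  -- Only the tangential part of the gradient enters the mixed term, and this part is small when the
  -- tilt `D` is small.
  have hcross : |fderiv ℝ (heightSq g) z (S.proj (z - p))| ≤ 2 * (F * √D) := by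
    rw [fderiv_heightSq (hg.differentiableOn (by simp)) hz, abs_mul, abs_two]
    gcongr
    refine (abs_real_inner_le_norm _ _).trans ?_
    gcongr
    refine Real.le_sqrt_of_sq_le ?_
    have h := norm_sq_map_starProjection_le (sndCLM m n - fderiv ℝ g z.fst ∘L fstCLM m n) e (z - p)
    refine h.trans ?_
    have h1 : ‖z - p‖ ^ 2 ≤ 1 := pow_le_one₀ (norm_nonneg _) hp
    exact mul_le_of_le_one_right hD0 h1
  have hm1 : (1 : ℝ) ≤ m := by exact_mod_cast hm
  have ht0 : 0 ≤ ‖z - p‖ ^ 2 := sq_nonneg _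
  have ht1 : ‖z - p‖ ^ 2 ≤ 1 := pow_le_one₀ (norm_nonneg _) hp
  rw [hdiv, hf]
  rw [hf] at hlap
  exact barrier_estimate ht0 ht1 hD0 hlap hcross hm1

end HeightFunction

/-! ### Comparison with the distance and conclusion -/

section Main

variable {m n : ℕ} {M : Set (Space m n)}
  {g : EuclideanSpace ℝ (Fin m) → EuclideanSpace ℝ (Fin n)}

theorem infEDist_sq_le_heightSq
    (hM : M ∩ cyl m n 2 = {z | z.fst ∈ Metric.ball 0 2 ∧ z.snd = g z.fst})
    {z : Space m n} (hz : z ∈ cyl m n 2) :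
    Metric.infEDist z M ^ 2 ≤ ENNReal.ofReal (heightSq g z) := by
  have h1 : Metric.infEDist z M ≤ ENNReal.ofReal ‖z.snd - g z.fst‖ := by
    refine (Metric.infEDist_le_edist_of_mem (graphPt_mem hM (mem_ball_of_mem_cyl hz))).trans ?_
    have h2 : z - graphPt g z.fst = inrPt m (z.snd - g z.fst) :=
      space_ext (by simp) (by simp)
    rw [edist_dist, dist_eq_norm, h2, norm_inrPt]
  rw [heightSq, ENNReal.ofReal_pow (norm_nonneg _)]
  gcongr

/-- The vertical distance from an almost flat graph is comparable to the distance. -/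
theorem heightSq_le_infEDist_sq
    (hM : M ∩ cyl m n 2 = {z | z.fst ∈ Metric.ball 0 2 ∧ z.snd = g z.fst})
    (hg : DifferentiableOn ℝ g (Metric.ball 0 2))
    (hg0 : ∀ x ∈ Metric.ball (0 : EuclideanSpace ℝ (Fin m)) 2, ‖g x‖ ≤ 1)
    (hg1 : ∀ x ∈ Metric.ball (0 : EuclideanSpace ℝ (Fin m)) 2, ‖fderiv ℝ g x‖ ≤ 1 / 2)
    {z : Space m n} (hz1 : ‖z.fst‖ < 1) (hz2 : ‖z.snd‖ < 1) :
    ENNReal.ofReal (heightSq g z) ≤ 4 * Metric.infEDist z M ^ 2 := by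
  have hzb : z.fst ∈ Metric.ball (0 : EuclideanSpace ℝ (Fin m)) 2 := by
    rw [mem_ball_zero_iff]; linarith
  have h1 : ENNReal.ofReal (‖z.snd - g z.fst‖ / 2) ≤ Metric.infEDist z M := by
    refine Metric.le_infEDist.2 fun p hp => ?_
    rw [edist_dist, dist_eq_norm]
    refine ENNReal.ofReal_le_ofReal ?_
    have hfst : ‖z.fst - p.fst‖ ≤ ‖z - p‖ :=
      WithLp.norm_fst_le (p := 2) (β := EuclideanSpace ℝ (Fin n)) _ (z - p)
    have hsnd : ‖z.snd - p.snd‖ ≤ ‖z - p‖ :=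
      WithLp.norm_snd_le (p := 2) (α := EuclideanSpace ℝ (Fin m)) (z - p)
    by_cases hpc : p ∈ cyl m n 2
    · obtain ⟨hpb, hpg⟩ := eq_graphPt_of_mem hM hp hpc
      have hps : p.snd = g p.fst := by rw [hpg]; rfl
      have hlip : ‖g p.fst - g z.fst‖ ≤ 1 / 2 * ‖p.fst - z.fst‖ :=
        (convex_ball _ _).norm_image_sub_le_of_norm_fderiv_le
          (fun x hx => hg.differentiableAt (Metric.isOpen_ball.mem_nhds hx)) hg1 hzb hpb
      have htri : ‖z.snd - g z.fst‖ ≤ ‖z.snd - p.snd‖ + ‖g p.fst - g z.fst‖ := by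
        rw [hps]
        exact (norm_sub_le_norm_sub_add_norm_sub _ _ _)
      rw [norm_sub_rev p.fst] at hlip
      linarith [norm_nonneg (z - p)]
    -- Nothing is known about `M` outside the cylinder of radius `2`, but such points lie at
    -- distance at least `1` from `z`, while the height at `z` is at most `2`.
    · have hp2 : 2 ≤ ‖p.fst‖ := not_lt.1 hpc
      have h3 : ‖p.fst‖ - ‖z.fst‖ ≤ ‖z.fst - p.fst‖ := by
        rw [norm_sub_rev]; exact norm_sub_norm_le _ _
      have h4 : ‖z.snd - g z.fst‖ ≤ ‖z.snd‖ + ‖g z.fst‖ := norm_sub_le _ _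
      have h5 := hg0 _ hzb
      linarith
  have h2 : heightSq g z = 4 * (‖z.snd - g z.fst‖ / 2) ^ 2 := by
    rw [heightSq]; ring
  rw [h2, ENNReal.ofReal_mul (by norm_num), ENNReal.ofReal_pow (by positivity)]
  have h3 : ENNReal.ofReal 4 = 4 := by simp
  rw [h3]
  gcongr

theorem closedBall_subset_cyl {p : Space m n} (hp : p ∈ cyl m n (1 / 2)) :
    Metric.closedBall p (1 / 4) ⊆ cyl m n 1 := by
  intro z hz
  rw [Metric.mem_closedBall, dist_eq_norm] at hz
  have hp' : ‖p.fst‖ < 1 / 2 := hp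
  have h1 : ‖z.fst - p.fst‖ ≤ ‖z - p‖ :=
    WithLp.norm_fst_le (p := 2) (β := EuclideanSpace ℝ (Fin n)) _ (z - p)
  have h2 : ‖z.fst‖ ≤ ‖z.fst - p.fst‖ + ‖p.fst‖ := by
    simpa using norm_add_le (z.fst - p.fst) p.fst
  show ‖z.fst‖ < 1
  linarith

theorem cyl_mono {r s : ℝ} (h : r ≤ s) : cyl m n r ⊆ cyl m n s :=
  fun z (hz : ‖z.fst‖ < r) => show ‖z.fst‖ < s from hz.trans_le h

/-- The height bound at points of positive lower density. -/
theorem exists_heightSq_le (m n : ℕ) (hm : 1 ≤ m) : ∃ K : ℝ, 0 ≤ K ∧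
    ∀ {M : Set (Space m n)} {g : EuclideanSpace ℝ (Fin m) → EuclideanSpace ℝ (Fin n)}
      {V : Measure (Space m n × Gr m (Space m n))} {δ k : ℝ},
      M ∩ cyl m n 2 = {z | z.fst ∈ Metric.ball 0 2 ∧ z.snd = g z.fst} →
      ContDiffOn ℝ ∞ g (Metric.ball 0 2) →
      (∀ x ∈ Metric.ball (0 : EuclideanSpace ℝ (Fin m)) 2, ‖fderiv ℝ g x‖ ≤ 1 / 2) →
      (∀ x ∈ Metric.ball (0 : EuclideanSpace ℝ (Fin m)) 2,
        2 * ‖fderiv ℝ (fderiv ℝ g) x‖ ≤ δ) →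
      Module.finrank ℝ (Space m n) * δ ^ 2 ≤ 1 / 40 →
      (∀ q ∈ M ∩ cyl m n 1, ‖meanCurvature M q‖ ≤ k) →
      IsVarifold (cyl m n 1) V → IsStationary (cyl m n 1) V →
      ∀ {p : Space m n}, p ∈ cyl m n (1 / 2) →
      (∀ᶠ r in 𝓝[>] (0 : ℝ),
        ENNReal.ofReal (hatIntegral m / 2 * r ^ m) ≤ weight V (Metric.closedBall p r)) →
      ENNReal.ofReal (heightSq g p) ≤ ENNReal.ofReal K *
        ∫⁻ z in Metric.closedBall p (1 / 4),
          ENNReal.ofReal (2 * heightSq g z + 85 * k ^ 2) ∂(weight V) := by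
  obtain ⟨K, hK0, hK⟩ := exists_mean_value_bound (E := Space m n) m hm (ρ := 1 / 4) (by norm_num)
  have hc : 0 < hatIntegral m / 2 := half_pos (hatIntegral_pos m)
  refine ⟨K / (hatIntegral m / 2), by positivity, ?_⟩
  intro M g V δ k hM hg hDg hD2g hδ hk hV hstat p hp hdens
  have hsub := closedBall_subset_cyl hp
  have h12 : cyl m n 1 ⊆ cyl m n 2 := cyl_mono (by norm_num)
  have hh := (contDiffOn_barrier hg p k).mono h12
  have hint : ∀ σ, σ ≤ 1 / 4 →
      IntegrableOn (barrier g p k) (Metric.closedBall p σ) (weight V) := by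
    intro σ hσ
    have hs := (Metric.closedBall_subset_closedBall hσ).trans hsub
    exact (hh.continuousOn.mono hs).integrableOn_of_subset_isCompact (isCompact_closedBall p σ)
      Metric.isClosed_closedBall.measurableSet subset_rfl
      (weight_lt_top hV (isCompact_closedBall p σ) hs).ne
  set I := ∫ z in Metric.closedBall p (1 / 4), barrier g p k z ∂(weight V) with hI
  have hI0 : 0 ≤ I := integral_nonneg fun z => barrier_nonneg p k z
  have hmv : ∀ σ, 0 < σ → σ ≤ 1 / 8 →
      ∫ z in Metric.closedBall p σ, barrier g p k z ∂(weight V) ≤ K * σ ^ m * I := by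
    intro σ hσ hσ8
    refine hK (isOpen_cyl 1) hV hstat hsub hh ((contDiffOn_barrierGrad hg p k).mono h12)
      (fun z hz => hasFDerivAt_barrier hg p k (h12 hz)) (fun z _ => barrier_nonneg p k z)
      (fun z hz S => ?_) σ hσ (by nlinarith)
    have hz1 := hsub hz
    have hzb := mem_ball_of_mem_cyl (h12 hz1)
    refine divAlong_barrierGrad_nonneg hm hM hg (h12 hz1) (hDg _ hzb) (hD2g _ hzb) hδ
      (hk _ ⟨graphPt_mem hM hzb, hz1⟩) ?_ S
    rw [Metric.mem_closedBall, dist_eq_norm] at hz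
    linarith
  have hle := le_of_mean_value_of_density hc (mul_nonneg hK0 hI0) (σ₀ := 1 / 8) (by norm_num)
    (hh.continuousOn.continuousAt ((isOpen_cyl 1).mem_nhds (cyl_mono (by norm_num) hp)))
    (fun σ _ hσ => hint σ (by linarith))
    (fun σ _ hσ => (weight_lt_top hV (isCompact_closedBall p σ)
      ((Metric.closedBall_subset_closedBall (by linarith)).trans hsub)).ne) hdens hmv
  -- Both quadratic corrections vanish at the centre, so bounding the barrier there bounds the
  -- height itself.
  have hbp : barrier g p k p = heightSq g p := by simp [barrier]
  rw [hbp, mul_div_right_comm] at hle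
  refine (ENNReal.ofReal_le_ofReal hle).trans ?_
  rw [ENNReal.ofReal_mul (by positivity), hI,
    ofReal_integral_eq_lintegral_ofReal (hint _ le_rfl)
      (Eventually.of_forall fun z => barrier_nonneg p k z)]
  gcongr ENNReal.ofReal _ * ?_
  refine setLIntegral_mono' Metric.isClosed_closedBall.measurableSet fun z hz => ?_
  refine ENNReal.ofReal_le_ofReal ?_
  rw [Metric.mem_closedBall, dist_eq_norm] at hz
  have ht : ‖z - p‖ ^ 2 ≤ 1 := pow_le_one₀ (norm_nonneg _) (by linarith)
  have hz0 := heightSq_nonneg (g := g) z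
  unfold barrier
  have h1 : (1 + ‖z - p‖ ^ 2 / 16) * heightSq g z ≤ 2 * heightSq g z := by
    gcongr; linarith
  have h2 : 85 * k ^ 2 * ‖z - p‖ ^ 2 ≤ 85 * k ^ 2 * 1 := by gcongr
  linarith

end Main

end HeightBound

end

theorem proposition2p7 (m n : ℕ) (hm : 1 ≤ m) (hn : 1 ≤ n) :
    ∃ (C : ℝ≥0) (δ₀ : ℝ), 0 < δ₀ ∧
      ∀ (δ : ℝ) (M : Set (HeightBound.Space m n))
        (V : Measure (HeightBound.Space m n × HeightBound.Gr m (HeightBound.Space m n))),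
        δ ≤ δ₀ →
        HeightBound.IsSmoothSubmanifold M →
        HeightBound.IsFlat M 2 δ →
        HeightBound.IsIntegralVarifold (HeightBound.cyl m n 1) V →
        HeightBound.IsStationary (HeightBound.cyl m n 1) V →
        HeightBound.vsupp (HeightBound.cyl m n 1) V ⊆ {z | ‖z.fst‖ < 1 ∧ ‖z.snd‖ < 1} →
        (⨆ z ∈ HeightBound.vsupp (HeightBound.cyl m n 1) V ∩ HeightBound.cyl m n (1 / 2),
            Metric.infEDist z M ^ 2) ≤
          C * ((∫⁻ z in HeightBound.cyl m n 1, Metric.infEDist z M ^ 2 ∂(HeightBound.weight V)) +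
            HeightBound.weight V (HeightBound.cyl m n 1) *
              ⨆ p ∈ M ∩ HeightBound.cyl m n 1, ‖HeightBound.meanCurvature M p‖ₑ ^ 2) := by
  open HeightBound in
  obtain ⟨K, hK0, hK⟩ := exists_heightSq_le m n hm
  set N : ℝ := ((Module.finrank ℝ (Space m n) : ℕ) : ℝ) with hN
  have hN0 : 0 ≤ N := Nat.cast_nonneg _
  -- The summand `1` keeps the constant nonzero, so that the right-hand side is infinite when `H_M`
  -- is unbounded. The choice of `δ₀` ensures both `δ ≤ 1/7` and `N δ² ≤ 1/40`.
  refine ⟨85 * K.toNNReal + 1, 1 / (7 * (N + 1)), by positivity, ?_⟩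
  intro δ M V hδ hMsm hflat hV hstat hsupp
  obtain ⟨g, hg2, hM, hgδ⟩ := hflat
  have hgd : DifferentiableOn ℝ g (Metric.ball 0 2) := hg2.differentiableOn (by simp)
  have hg : ContDiffOn ℝ ∞ g (Metric.ball 0 2) := contDiffOn_of_isSmoothSubmanifold hMsm hM hgd
  have hδ0 : 0 ≤ δ := le_trans (by positivity) (hgδ 0 (by simp))
  have hδ7 : δ ≤ 1 / 7 := hδ.trans (by gcongr; linarith)
  have hg0 : ∀ x ∈ Metric.ball (0 : EuclideanSpace ℝ (Fin m)) 2, ‖g x‖ ≤ 1 := fun x hx => by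
    linarith [hgδ x hx, norm_nonneg (fderiv ℝ g x), norm_nonneg (fderiv ℝ (fderiv ℝ g) x)]
  have hg1 : ∀ x ∈ Metric.ball (0 : EuclideanSpace ℝ (Fin m)) 2, ‖fderiv ℝ g x‖ ≤ 1 / 2 :=
    fun x hx => by
      linarith [hgδ x hx, norm_nonneg (g x), norm_nonneg (fderiv ℝ (fderiv ℝ g) x)]
  have hg2' : ∀ x ∈ Metric.ball (0 : EuclideanSpace ℝ (Fin m)) 2,
      2 * ‖fderiv ℝ (fderiv ℝ g) x‖ ≤ δ := fun x hx => by
    linarith [hgδ x hx, norm_nonneg (g x), norm_nonneg (fderiv ℝ g x)]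
  have hNδ : N * δ ^ 2 ≤ 1 / 40 := by
    have h1 : δ * (7 * (N + 1)) ≤ 1 := (le_div_iff₀ (by positivity)).1 hδ
    nlinarith [mul_nonneg hN0 hδ0]
  set μ := weight V with hμ
  set Hs := ⨆ p ∈ M ∩ cyl m n 1, ‖meanCurvature M p‖ₑ ^ 2 with hHs
  set R : ℝ≥0∞ := ((85 * K.toNNReal + 1 : ℝ≥0) : ℝ≥0∞) *
    ((∫⁻ z in cyl m n 1, Metric.infEDist z M ^ 2 ∂μ) + μ (cyl m n 1) * Hs) with hR
  refine iSup₂_le fun z hz => ?_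
  obtain ⟨⟨hzs, hz1⟩, hz2⟩ := hz
  refine (infEDist_sq_le_heightSq hM (cyl_mono (by norm_num) hz1)).trans ?_
  -- A point of the support forces positive mass in the cylinder, so the product with an infinite
  -- supremum is infinite and the convention `0 * ∞ = 0` does not interfere.
  by_cases hHtop : Hs = ⊤
  · have hpos : 0 < μ (cyl m n 1) :=
      (Measure.mem_support_iff_forall z).1 hzs _ ((isOpen_cyl 1).mem_nhds hz1)
    have hRtop : R = ⊤ := by
      rw [hR, hHtop, ENNReal.mul_top hpos.ne', add_top, ENNReal.mul_top (by simp)]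
    rw [hRtop]
    exact le_top
  set k := √Hs.toReal with hk
  have hk2 : k ^ 2 = Hs.toReal := Real.sq_sqrt ENNReal.toReal_nonneg
  have hkH : ∀ q ∈ M ∩ cyl m n 1, ‖meanCurvature M q‖ ≤ k := by
    intro q hq
    refine Real.le_sqrt_of_sq_le ?_
    have h1 : ‖meanCurvature M q‖ₑ ^ 2 ≤ Hs :=
      le_iSup₂ (f := fun p (_ : p ∈ M ∩ cyl m n 1) => ‖meanCurvature M p‖ₑ ^ 2) q hq
    have h2 := ENNReal.toReal_mono hHtop h1
    simpa using h2
  have hae1 : ∀ᵐ q ∂μ, q ∈ cyl m n 1 → ‖q.fst‖ < 1 ∧ ‖q.snd‖ < 1 := by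
    filter_upwards [(Measure.support_mem_ae : μ.support ∈ ae μ)] with q hq hq1
    exact hsupp ⟨hq, hq1⟩
  have hgood : ∀ᵐ p ∂μ, p ∈ cyl m n (1 / 2) → ENNReal.ofReal (heightSq g p) ≤ R := by
    filter_upwards [hV.ae_density] with p hp hp2
    refine (hK hM hg hg1 hg2' hNδ hkH hV.1 hstat hp2 hp).trans ?_
    have h1 : ∫⁻ z in Metric.closedBall p (1 / 4),
        ENNReal.ofReal (2 * heightSq g z + 85 * k ^ 2) ∂μ
        ≤ ∫⁻ z in cyl m n 1, 85 * (Metric.infEDist z M ^ 2 + Hs) ∂μ := by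
      refine (lintegral_mono_set (closedBall_subset_cyl hp2)).trans ?_
      refine lintegral_mono_ae ((ae_restrict_iff' (isOpen_cyl 1).measurableSet).2 ?_)
      filter_upwards [hae1] with q hq hq1
      obtain ⟨hq2, hq3⟩ := hq hq1
      have h2 := heightSq_le_infEDist_sq hM hgd hg0 hg1 hq2 hq3
      have h3 := heightSq_nonneg (g := g) q
      rw [ENNReal.ofReal_add (by positivity) (by positivity), ENNReal.ofReal_mul (by norm_num),
        ENNReal.ofReal_mul (by norm_num), hk2, ENNReal.ofReal_toReal hHtop, mul_add]
      refine add_le_add ?_ ?_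
      · calc ENNReal.ofReal 2 * ENNReal.ofReal (heightSq g q)
            ≤ ENNReal.ofReal 2 * (4 * Metric.infEDist q M ^ 2) := by gcongr
          _ = 8 * Metric.infEDist q M ^ 2 := by
            rw [← mul_assoc]; congr 1; norm_num
          -- Enlarging `8` to `85` gives the distance and curvature terms a common factor.
          _ ≤ 85 * Metric.infEDist q M ^ 2 := by gcongr; norm_num
      · gcongr; simp
    have h4 : ∫⁻ z in cyl m n 1, 85 * (Metric.infEDist z M ^ 2 + Hs) ∂μ
        = 85 * ((∫⁻ z in cyl m n 1, Metric.infEDist z M ^ 2 ∂μ) + μ (cyl m n 1) * Hs) := by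
      rw [lintegral_const_mul' _ _ (by norm_num), lintegral_add_right _ measurable_const,
        setLIntegral_const, mul_comm Hs]
    calc ENNReal.ofReal K * _ ≤ ENNReal.ofReal K * (85 *
          ((∫⁻ z in cyl m n 1, Metric.infEDist z M ^ 2 ∂μ) + μ (cyl m n 1) * Hs)) := by
          rw [← h4]; gcongr
      _ = ((85 * K.toNNReal : ℝ≥0) : ℝ≥0∞) *
          ((∫⁻ z in cyl m n 1, Metric.infEDist z M ^ 2 ∂μ) + μ (cyl m n 1) * Hs) := by
          rw [← mul_assoc, mul_comm (ENNReal.ofReal K)]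
          simp [ENNReal.ofReal]
      _ ≤ R := by
          rw [hR]; gcongr; simp
  -- If the bound failed at `z`, it would fail by continuity on a neighbourhood of `z`, which has
  -- positive weight since `z` is in the support. This contradicts the almost everywhere bound.
  by_contra! hlt
  have hcont : ContinuousAt (heightSq g) z :=
    (contDiffOn_heightSq hg).continuousOn.continuousAt
      ((isOpen_cyl 2).mem_nhds (cyl_mono (by norm_num) hz1))
  have hev : ∀ᶠ p in 𝓝 z, R < ENNReal.ofReal (heightSq g p) :=
    (ENNReal.continuous_ofReal.continuousAt.comp hcont).eventually (lt_mem_nhds hlt)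
  have hpos := (Measure.mem_support_iff_forall z).1 hzs _
    (inter_mem hev ((isOpen_cyl (1 / 2)).mem_nhds hz2))
  refine hpos.ne' (measure_mono_null ?_ (ae_iff.1 hgood))
  rintro p ⟨hp1, hp2⟩ hp3
  exact absurd (hp3 hp2) (not_le.2 hp1)
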